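/- Proposition 5.2 with Corollary 5.3 (invariance of $X$-colorings under handlebody-knot moves). A biquandle is a set $X$ with operations $\underline{\triangleright},\overline{\triangleright}:X\times X\to X$ such that $x\underline{\triangleright}x=x\overline{\triangleright}x$; the maps $x\mapsto x\underline{\triangleright}y$, $x\mapsto x\overline{\triangleright}y$ (each $y$) and $(x,y)\mapsto(y\overline{\triangleright}x,\,x\underline{\triangleright}y)$ are bijective; and $(x\underline{\triangleright}y)\underline{\triangleright}(z\underline{\triangleright}y)=(x\underline{\triangleright}z)\underline{\triangleright}(y\overline{\triangleright}z)$, $(x\underline{\triangleright}y)\overline{\triangleright}(z\underline{\triangleright}y)=(x\overline{\triangleright}z)\underline{\triangleright}(y\overline{\triangleright}z)$, $(x\overline{\triangleright}y)\overline{\triangleright}(z\overline{\triangleright}y)=(x\overline{\triangleright}z)\overline{\triangleright}(y\underline{\triangleright}z)$. A partially multiplicative biquandle is a biquandle $X$ with a subset $D\subset X\times X$ and a map $D\to X$, $(a,b)\mapsto ab$, such that (i) $x\mapsto ax$ and $x\mapsto xb$ are injective where defined; (ii) $(a,b\underline{\triangleright}a)\in D\Leftrightarrow(b,a\overline{\triangleright}b)\in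 D$, and then $a(b\underline{\triangleright}a)=b(a\overline{\triangleright}b)$; (iii) $(a,b)\in D\Leftrightarrow(a\underline{\triangleright}x,b\underline{\triangleright}(x\overline{\triangleright}a))\in D\Leftrightarrow(a\overline{\triangleright}x,b\overline{\triangleright}(x\underline{\triangleright}a))\in D$, and then $x\underline{\triangleright}(ab)=(x\underline{\triangleright}a)\underline{\triangleright}b$, $(ab)\underline{\triangleright}x=(a\underline{\triangleright}x)(b\underline{\triangleright}(x\overline{\triangleright}a))$, $x\overline{\triangleright}(ab)=(x\overline{\triangleright}a)\overline{\triangleright}b$, $(ab)\overline{\triangleright}x=(a\overline{\triangleright}x)(b\overline{\triangleright}(x\underline{\triangleright}a))$; (iv) $(a,b),(ab,c)\in D\Leftrightarrow(b,c),(a,bc)\in D$, and then $(ab)c=a(bc)$; (v) $(a,b),(c,d)\in D$ and $ab=cd$ if and only if there is $e\in X$ with $(a,e),(e,d)\in D$, $ae=c$, $ed=b$. A $Y$-oriented spatial trivalent graph diagram is a finite planar diagram, with crossings, of a trivalent graph (possibly with circle components) in $\mathbb R^3$, considered as a combinatorial planar diagram, together with a direction of every edge such that no vertex is a source or a sink.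 Its semiarcs are the pieces between consecutive crossing points (over or under) and vertices. An $X$-coloring assigns elements of $X$ to the semiarcs such that - at each crossing, if the under-semiarc lying to the left of the over-strand is colored $x$ and the over-semiarc lying to the left of the under-strand is colored $y$, then the other under- and over-semiarcs are colored $x\underline{\triangleright}y$ and $y\overline{\triangleright}x$, respectively; - at each vertex, where two edges merge into one or one splits into two, if the two edges are colored $a$ (left) and $b$ (right), as seen along their direction, then $(a,b)\in D$ and the one edge is colored $ab$. The handlebody-knot Reidemeister moves are the local moves I (kink), II, III (the moves of link diagrams), IV (crossing two legs of a vertex), V (moving a strand over or under a vertex) and VI (the IH-move: replacing an edge joining two vertices by an edge joining the other neighboring pairs of the four legs), in all rotations and mirror images, in both directions, and with all $Y$-orientations of the two sides which agree on the boundary of the disk of the move. Let $X$ be a partially multiplicative biquandle. 1. If $\Gamma$ is a $Y$-oriented spatial trivalent graph diagram with an $X$-coloring and $\Gamma'$ is obtained from $\Gamma$ by a handlebody-knot Reidemeister move, then there is a unique $X$-coloring of $\Gamma'$ which agrees with the coloring of $\Gamma$ outside the neighborhood of the move. 2. Consequently, the number (cardinality of the set) of $X$-colorings is invariant under the handlebody-knot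 Reidemeister moves: if $\Gamma$ and $\Gamma'$ are related by a finite sequence of such moves, that is, if they represent the same $S^1$-oriented handlebody-knot, then they have equally many $X$-colorings. -/

import Mathlib

universe u

/-- A biquandle: a set with two operations `passUnder` (written `x ▹ᵤ y`) and
`passOver` (written `x ▹ₒ y`). -/
class Biquandle (X : Type u) where
  passUnder : X → X → X
  passOver : X → X → X
  under_self : ∀ x, passUnder x x = passOver x x
  over_bijective : ∀ y, Function.Bijective fun x => passOver x y
  under_bijective : ∀ y, Function.Bijective fun x => passUnder x y
  switch_bijective : Function.Bijective fun p : X × X => (passOver p.2 p.1, passUnder p.1 p.2)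
  exchange_uu : ∀ x y z,
    passUnder (passUnder x y) (passUnder z y) = passUnder (passUnder x z) (passOver y z)
  exchange_uo : ∀ x y z,
    passOver (passUnder x y) (passUnder z y) = passUnder (passOver x z) (passOver y z)
  exchange_oo : ∀ x y z,
    passOver (passOver x y) (passOver z y) = passOver (passOver x z) (passUnder y z)

infixl:70 " ▹ᵤ " => Biquandle.passUnder
infixl:70 " ▹ₒ " => Biquandle.passOver

/-- A partially multiplicative biquandle. The partial multiplication is defined on the pairs
`(a, b)` with `D a b`. -/
class PartiallyMultiplicativeBiquandle (X : Type u) extends Biquandle X where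
  D : X → X → Prop
  mul : ∀ a b, D a b → X
  mul_left_injective : ∀ a x y (hx : D a x) (hy : D a y), mul a x hx = mul a y hy → x = y
  mul_right_injective : ∀ b x y (hx : D x b) (hy : D y b), mul x b hx = mul y b hy → x = y
  D_swap : ∀ a b, D a (b ▹ᵤ a) ↔ D b (a ▹ₒ b)
  mul_swap : ∀ a b (h : D a (b ▹ᵤ a)) (h' : D b (a ▹ₒ b)), mul a (b ▹ᵤ a) h = mul b (a ▹ₒ b) h'
  D_under : ∀ a b x, D a b ↔ D (a ▹ᵤ x) (b ▹ᵤ (x ▹ₒ a))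
  D_over : ∀ a b x, D a b ↔ D (a ▹ₒ x) (b ▹ₒ (x ▹ᵤ a))
  under_mul : ∀ a b x (h : D a b), x ▹ᵤ mul a b h = (x ▹ᵤ a) ▹ᵤ b
  over_mul : ∀ a b x (h : D a b), x ▹ₒ mul a b h = (x ▹ₒ a) ▹ₒ b
  mul_under : ∀ a b x (h : D a b) (h' : D (a ▹ᵤ x) (b ▹ᵤ (x ▹ₒ a))),
    mul a b h ▹ᵤ x = mul (a ▹ᵤ x) (b ▹ᵤ (x ▹ₒ a)) h'
  mul_over : ∀ a b x (h : D a b) (h' : D (a ▹ₒ x) (b ▹ₒ (x ▹ᵤ a))),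
    mul a b h ▹ₒ x = mul (a ▹ₒ x) (b ▹ₒ (x ▹ᵤ a)) h'
  D_assoc : ∀ a b c,
    (∃ h : D a b, D (mul a b h) c) ↔ (∃ h : D b c, D a (mul b c h))
  mul_assoc : ∀ a b c (h₁ : D a b) (h₂ : D (mul a b h₁) c) (h₃ : D b c) (h₄ : D a (mul b c h₃)),
    mul (mul a b h₁) c h₂ = mul a (mul b c h₃) h₄
  mul_eq_mul_iff : ∀ a b c d,
    (∃ (h : D a b) (h' : D c d), mul a b h = mul c d h') ↔
      ∃ e, ∃ (h : D a e) (h' : D e d), mul a e h = c ∧ mul e d h' = b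

/-- `IsProd a b c`: the product `ab` is defined and equal to `c`. -/
def IsProd {X : Type u} [PartiallyMultiplicativeBiquandle X] (a b c : X) : Prop :=
  ∃ h : PartiallyMultiplicativeBiquandle.D a b, PartiallyMultiplicativeBiquandle.mul a b h = c

/-- The places where an end of an arc can be attached in a diagram with crossings `C`, trivalent
vertices `V` and `n` endpoints on the boundary circle: four ports at every crossing, three at
every vertex (both numbered counterclockwise), one at every boundary point. At a crossing the
strand through the ports `0` and `2` passes under the strand through the ports `1` and `3`. -/
abbrev Port (C V : Type) (n : ℕ) : Type := (C × Fin 4) ⊕ (V × Fin 3) ⊕ Fin n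

/-- An unoriented spatial trivalent graph diagram in a disk, given combinatorially, with `n`
endpoints on the boundary circle, numbered counterclockwise. `E` is the set of arcs into which the
diagram is cut by its crossing points and its vertices, and `arc p` is the arc with an end at the
port `p`. Every arc has two ends or is a closed curve without ends. -/
structure Picture (n : ℕ) where
  C : Type
  V : Type
  E : Type
  finite_C : Finite C
  finite_V : Finite V
  finite_E : Finite E
  arc : Port C V n → E
  ends : ∀ p, ∃! q, q ≠ p ∧ arc q = arc p

namespace Picture

variable {n : ℕ}

/-- The arc at port `i` of the crossing `c`. -/
abbrev arcC (P : Picture n) (c : P.C) (i : Fin 4) : P.E := P.arc (Sum.inl (c, i))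

/-- The arc at port `i` of the vertex `v`. -/
abbrev arcV (P : Picture n) (v : P.V) (i : Fin 3) : P.E := P.arc (Sum.inr (Sum.inl (v, i)))

/-- The arc at the boundary point `i`. -/
abbrev arcB (P : Picture n) (i : Fin n) : P.E := P.arc (Sum.inr (Sum.inr i))

/-- A `Y`-orientation: a direction of every edge of the graph such that no vertex is a source or
a sink. `inward p` says that the arc at `p` is directed towards the port `p`. Directions are
constant along arcs and along the strands through a crossing. (Closed curves without
crossings and vertices need no data: both directions give the same combinatorial diagram.) -/
structure YOrientation (P : Picture n) where
  inward : Port P.C P.V n → Bool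
  arc_dir : ∀ p q, p ≠ q → P.arc p = P.arc q → inward p ≠ inward q
  crossing_dir : ∀ (c : P.C) (i : Fin 4), inward (Sum.inl (c, i)) ≠ inward (Sum.inl (c, i + 2))
  vertex_dir : ∀ v : P.V, (∃ i : Fin 3, inward (Sum.inr (Sum.inl (v, i))) = true) ∧
    ∃ i : Fin 3, inward (Sum.inr (Sum.inl (v, i))) = false

namespace YOrientation

variable {P : Picture n}

abbrev inC (o : P.YOrientation) (c : P.C) (i : Fin 4) : Bool := o.inward (Sum.inl (c, i))

abbrev inV (o : P.YOrientation) (v : P.V) (i : Fin 3) : Bool :=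
  o.inward (Sum.inr (Sum.inl (v, i)))

abbrev inB (o : P.YOrientation) (i : Fin n) : Bool := o.inward (Sum.inr (Sum.inr i))

/-- The port of the under-strand at `c` which lies on the left of the directed over-strand. -/
def leftUnder (o : P.YOrientation) (c : P.C) : Fin 4 := if o.inC c 1 then 0 else 2

/-- The port of the over-strand at `c` which lies on the left of the directed under-strand. -/
def leftOver (o : P.YOrientation) (c : P.C) : Fin 4 := if o.inC c 0 then 3 else 1

/-- `X`-colorings of a `Y`-oriented diagram. At a crossing, if `x` (under) and `y` (over) are the
colors of the two semiarcs around the corner to the left of both strands, then the semiarcs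
opposite to them are colored `x ▹ᵤ y` and `y ▹ₒ x`. At a vertex `v`, the port `i` of the edge
whose direction differs from that of the other two is colored by the product `ab` of the colors
`a` and `b` of the edges on the left and on the right, as seen along the direction of the edges. -/
structure IsColoring {X : Type u} [PartiallyMultiplicativeBiquandle X] (o : P.YOrientation)
    (f : P.E → X) : Prop where
  under_rule : ∀ c, f (P.arcC c (o.leftUnder c + 2)) =
    f (P.arcC c (o.leftUnder c)) ▹ᵤ f (P.arcC c (o.leftOver c))
  over_rule : ∀ c, f (P.arcC c (o.leftOver c + 2)) =
    f (P.arcC c (o.leftOver c)) ▹ₒ f (P.arcC c (o.leftUnder c))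
  merge : ∀ v i, o.inV v (i + 1) = true → o.inV v (i + 2) = true → o.inV v i = false →
    IsProd (f (P.arcV v (i + 1))) (f (P.arcV v (i + 2))) (f (P.arcV v i))
  split : ∀ v i, o.inV v (i + 1) = false → o.inV v (i + 2) = false → o.inV v i = true →
    IsProd (f (P.arcV v (i + 2))) (f (P.arcV v (i + 1))) (f (P.arcV v i))

end YOrientation

/-- The counterclockwise next port at the same crossing or vertex. -/
def next (P : Picture n) : Port P.C P.V n → Port P.C P.V n
  | Sum.inl (c, i) => Sum.inl (c, i + 1)
  | Sum.inr (Sum.inl (v, i)) => Sum.inr (Sum.inl (v, i + 1))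
  | Sum.inr (Sum.inr i) => Sum.inr (Sum.inr i)

/-- The faces of a diagram without boundary points, as orbits of corners. The corner between `p`
and `next p` is denoted by `p`; it is followed, along the left side of the arc leaving through
`p`, by the corner `q` for which `next q` is the other end of that arc. -/
def Face (P : Picture 0) : Type :=
  Quot fun p q : Port P.C P.V 0 => P.next q ≠ p ∧ P.arc (P.next q) = P.arc p

/-- The connected components which contain a crossing or a vertex. -/
def Component (P : Picture 0) : Type :=
  Quot fun p q : Port P.C P.V 0 => q = P.next p ∨ P.arc q = P.arc p

/-- Planarity: Euler's formula `nodes - arcs + faces = 2 * components` (times two), where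
the number of arcs with ends is half the number of ports. -/
def IsPlanar (P : Picture 0) : Prop :=
  2 * (Nat.card P.C + Nat.card P.V) + 2 * Nat.card P.Face =
    Nat.card (Port P.C P.V 0) + 4 * Nat.card P.Component

/-- Exchange of over and under at all crossings. -/
def mirror (P : Picture n) : Picture n where
  C := P.C
  V := P.V
  E := P.E
  finite_C := P.finite_C
  finite_V := P.finite_V
  finite_E := P.finite_E
  arc := fun p => P.arc (Sum.map (Prod.map id (· + 1)) id p)
  ends := by
    have hb : Function.Bijective
        (Sum.map (Prod.map id (· + 1)) id : Port P.C P.V n → Port P.C P.V n) :=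
      Sum.map_bijective.2
        ⟨Function.bijective_id.prodMap (Equiv.addRight (1 : Fin 4)).bijective,
          Function.bijective_id⟩
    intro p
    obtain ⟨q, ⟨hq, hq'⟩, hu⟩ := P.ends (Sum.map (Prod.map id (· + 1)) id p)
    obtain ⟨q, rfl⟩ := hb.2 q
    refine ⟨q, ⟨fun h => hq (by rw [h]), hq'⟩, fun r hr => hb.1 (hu _ ⟨?_, hr.2⟩)⟩
    exact fun h => hr.1 (hb.1 h)

/-- The table of arcs of a diagram with `k` crossings, `l` vertices, `m` arcs and `n` boundary
points. -/
def table {k l m n : ℕ} (cr : Fin k → Fin 4 → Fin m) (ve : Fin l → Fin 3 → Fin m)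
    (bd : Fin n → Fin m) : Port (Fin k) (Fin l) n → Fin m :=
  Sum.elim (fun p => cr p.1 p.2) (Sum.elim (fun p => ve p.1 p.2) bd)

/-- A diagram given by its table of arcs. -/
abbrev ofTable {k l m n : ℕ} (cr : Fin k → Fin 4 → Fin m) (ve : Fin l → Fin 3 → Fin m)
    (bd : Fin n → Fin m)
    (h : ∀ p, ∃ q, (q ≠ p ∧ table cr ve bd q = table cr ve bd p) ∧
      ∀ r, (r ≠ p ∧ table cr ve bd r = table cr ve bd p) → r = q) : Picture n where
  C := Fin k
  V := Fin l
  E := Fin m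
  finite_C := inferInstance
  finite_V := inferInstance
  finite_E := inferInstance
  arc := table cr ve bd
  ends := h

section Moves

set_option synthInstance.maxSize 2000
set_option maxRecDepth 20000

/-- Move I: a strand. -/
def oneL : Picture 2 := ofTable (k := 0) (l := 0) (m := 1) ![] ![] ![0, 0] (by decide)

/-- Move I: a strand with a kink. -/
def oneR : Picture 2 :=
  ofTable (k := 1) (l := 0) (m := 3) ![![0, 0, 1, 2]] ![] ![1, 2] (by decide)

/-- Move II: two strands, one from boundary point `0` (bottom left) to `3` (top left) and one
from `1` (bottom right) to `2` (top right). -/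
def twoL : Picture 4 := ofTable (k := 0) (l := 0) (m := 2) ![] ![] ![0, 1, 1, 0] (by decide)

/-- Move II: the left strand is pushed under the right strand. -/
def twoR : Picture 4 :=
  ofTable (k := 2) (l := 0) (m := 6) ![![0, 1, 2, 3], ![2, 4, 5, 3]] ![] ![0, 1, 4, 5] (by decide)

/-- Move III: three strands from the boundary points `0`, `1`, `2` (bottom left, bottom, bottom
right) to the opposite points `3`, `4`, `5`; the first is the lowest and the third the highest.
The second, vertical strand passes on the left of the crossing of the other two. The
crossings are those of the strands 1 and 3, of 1 and 2, and of 2 and 3. -/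
def threeL : Picture 6 :=
  ofTable (k := 3) (l := 0) (m := 9)
    ![![6, 2, 3, 8], ![0, 1, 6, 7], ![7, 8, 4, 5]] ![] ![0, 1, 2, 3, 4, 5] (by decide)

/-- Move III: the vertical strand passes on the right of the crossing of the other two. -/
def threeR : Picture 6 :=
  ofTable (k := 3) (l := 0) (m := 9)
    ![![0, 8, 6, 5], ![6, 7, 3, 4], ![1, 2, 7, 8]] ![] ![0, 1, 2, 3, 4, 5] (by decide)

/-- Move IV: a vertex. -/
def fourL : Picture 3 :=
  ofTable (k := 0) (l := 1) (m := 3) ![] ![![0, 1, 2]] ![0, 1, 2] (by decide)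

/-- Move IV: a vertex two of whose legs cross each other. -/
def fourR : Picture 3 :=
  ofTable (k := 1) (l := 1) (m := 5) ![![4, 3, 1, 2]] ![![0, 3, 4]] ![0, 1, 2] (by decide)

/-- Move V: a vertex with one leg pointing down to the boundary point `0` and two legs pointing
up to the boundary points `2` and `3`; a strand from `4` (left) to `1` (right) passes over
the leg pointing down. -/
def fiveL : Picture 5 :=
  ofTable (k := 1) (l := 1) (m := 6) ![![0, 1, 5, 4]] ![![5, 2, 3]] ![0, 1, 2, 3, 4] (by decide)

/-- Move V: the strand passes over the two legs pointing up. -/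
def fiveR : Picture 5 :=
  ofTable (k := 2) (l := 1) (m := 8)
    ![![5, 1, 2, 7], ![6, 7, 3, 4]] ![![0, 5, 6]] ![0, 1, 2, 3, 4] (by decide)

/-- Move VI: the boundary points `0` (bottom left), `1` (bottom right) are joined to one vertex,
and `2` (top right), `3` (top left) to another. -/
def sixL : Picture 4 :=
  ofTable (k := 0) (l := 2) (m := 5) ![] ![![0, 1, 4], ![4, 2, 3]] ![0, 1, 2, 3] (by decide)

/-- Move VI: the points `3`, `0` are joined to one vertex and `1`, `2` to another. -/
def sixR : Picture 4 :=
  ofTable (k := 0) (l := 2) (m := 5) ![] ![![3, 0, 4], ![4, 1, 2]] ![0, 1, 2, 3] (by decide)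

end Moves

/-- The local pictures of the handlebody-knot Reidemeister moves, up to rotations of the disk and
up to exchanging over and under. -/
inductive BasicMove : {n : ℕ} → Picture n → Picture n → Prop
  | I : BasicMove oneL oneR
  | II : BasicMove twoL twoR
  | III : BasicMove threeL threeR
  | IV : BasicMove fourL fourR
  | V : BasicMove fiveL fiveR
  | VI : BasicMove sixL sixR

/-- The local pictures of the handlebody-knot Reidemeister moves, up to rotations of the disk. -/
inductive LocalMove : {n : ℕ} → Picture n → Picture n → Prop
  | basic {n : ℕ} {P Q : Picture n} (h : BasicMove P Q) : LocalMove P Q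
  | basic_symm {n : ℕ} {P Q : Picture n} (h : BasicMove P Q) : LocalMove Q P
  | mirror {n : ℕ} {P Q : Picture n} (h : BasicMove P Q) : LocalMove P.mirror Q.mirror
  | mirror_symm {n : ℕ} {P Q : Picture n} (h : BasicMove P Q) : LocalMove Q.mirror P.mirror

end Picture

/-- A `Y`-oriented spatial trivalent graph diagram, given by its planar combinatorial code. Its
semiarcs are the elements of `E`. (The position of the connected components of the diagram
relative to each other is not recorded; colorings do not depend on it.) -/
structure YDiagram extends Picture 0 where
  orient : toPicture.YOrientation
  planar : toPicture.IsPlanar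

/-- The set of `X`-colorings of a `Y`-oriented diagram. -/
def YDiagram.Coloring (Γ : YDiagram) (X : Type u) [PartiallyMultiplicativeBiquandle X] : Type u :=
  {f : Γ.E → X // Γ.orient.IsColoring f}

/-- `Gluing Γ o o'`: the diagram `Γ` is cut by a circle into an oriented outer part `T` and an
oriented inner part `P`. The crossings and vertices of `Γ` are those of `T` and of `P`, with
their ports and directions, and the semiarcs of `Γ` are the classes of arcs of `T` and
`P` under the relation generated by joining, for every `i`, the arcs of `T` and of `P` at the
boundary point `i`. -/
structure Gluing (Γ : YDiagram) {n : ℕ} {T P : Picture n} (o : T.YOrientation)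
    (o' : P.YOrientation) where
  crossing : T.C ⊕ P.C ≃ Γ.C
  vertex : T.V ⊕ P.V ≃ Γ.V
  arc : T.E ⊕ P.E → Γ.E
  arc_surjective : Function.Surjective arc
  arc_eq_iff : ∀ x y, arc x = arc y ↔
    Relation.EqvGen (fun x y => ∃ i, x = Sum.inl (T.arcB i) ∧ y = Sum.inr (P.arcB i)) x y
  arc_crossing_outer : ∀ c i, Γ.arcC (crossing (Sum.inl c)) i = arc (Sum.inl (T.arcC c i))
  arc_crossing_inner : ∀ c i, Γ.arcC (crossing (Sum.inr c)) i = arc (Sum.inr (P.arcC c i))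
  arc_vertex_outer : ∀ v i, Γ.arcV (vertex (Sum.inl v)) i = arc (Sum.inl (T.arcV v i))
  arc_vertex_inner : ∀ v i, Γ.arcV (vertex (Sum.inr v)) i = arc (Sum.inr (P.arcV v i))
  dir_crossing_outer : ∀ c i, Γ.orient.inC (crossing (Sum.inl c)) i = o.inC c i
  dir_crossing_inner : ∀ c i, Γ.orient.inC (crossing (Sum.inr c)) i = o'.inC c i
  dir_vertex_outer : ∀ v i, Γ.orient.inV (vertex (Sum.inl v)) i = o.inV v i
  dir_vertex_inner : ∀ v i, Γ.orient.inV (vertex (Sum.inr v)) i = o'.inV v i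
  dir_boundary : ∀ i, o.inB i ≠ o'.inB i

/-- A handlebody-knot Reidemeister move from `Γ` to `Γ'`: inside a disk, one side of one of the
moves I-VI (with any `Y`-orientation) is replaced by the other side, while the oriented part
`outer` of the diagram outside the disk is kept. As the boundary points of `outer` may be
numbered starting anywhere, the local picture may be rotated. -/
structure HandlebodyMove (Γ Γ' : YDiagram) where
  n : ℕ
  outer : Picture n
  inner : Picture n
  inner' : Picture n
  isMove : Picture.LocalMove inner inner'
  outerOrient : outer.YOrientation
  innerOrient : inner.YOrientation
  innerOrient' : inner'.YOrientation
  source : Gluing Γ outerOrient innerOrient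
  target : Gluing Γ' outerOrient innerOrient'

/-- Two colorings agree outside the neighborhood of a move. -/
def HandlebodyMove.Agree {Γ Γ' : YDiagram} (m : HandlebodyMove Γ Γ') {X : Type u}
    [PartiallyMultiplicativeBiquandle X] (f : Γ.Coloring X) (f' : Γ'.Coloring X) : Prop :=
  ∀ e : m.outer.E, f'.1 (m.target.arc (Sum.inl e)) = f.1 (m.source.arc (Sum.inl e))

/-- The equivalence relation on `Y`-oriented diagrams generated by the handlebody-knot
Reidemeister moves; its classes are the `S¹`-oriented handlebody-knots. -/
def HandlebodyEquiv : YDiagram → YDiagram → Prop :=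
  Relation.EqvGen fun Γ Γ' => Nonempty (HandlebodyMove Γ Γ')

section Crossings

variable {X : Type u} [Biquandle X]

open Biquandle

/-- The colors around a crossing: `x`, `y` are the colors of the under- and the over-semiarc around
the corner to the left of both strands, and `x'`, `y'` are those of the opposite semiarcs. -/
def CrossRel (x y x' y' : X) : Prop := x' = x ▹ᵤ y ∧ y' = y ▹ₒ x

theorem under_left_injective {x x' y : X} (h : x ▹ᵤ y = x' ▹ᵤ y) : x = x' :=
  (under_bijective y).1 h

theorem over_left_injective {x x' y : X} (h : x ▹ₒ y = x' ▹ₒ y) : x = x' :=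
  (over_bijective y).1 h

theorem switch_injective {x y x' y' : X} (hu : x ▹ᵤ y = x' ▹ᵤ y') (ho : y ▹ₒ x = y' ▹ₒ x') :
    x = x' ∧ y = y' :=
  Prod.mk.inj ((switch_bijective (X := X)).1 (a₁ := (x, y)) (a₂ := (x', y')) (Prod.ext ho hu))

theorem diagonal_injective {x y : X} (h : x ▹ᵤ x = y ▹ᵤ y) : x = y :=
  (switch_injective h (by rw [← under_self, ← under_self, h])).1

theorem eq_of_under_eq_over {x y : X} (h : x ▹ᵤ y = y ▹ₒ x) : x = y := by
  have h₁ := exchange_uu x y x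
  have h₂ := exchange_oo y x y
  rw [← h] at h₁ h₂
  rw [← under_self] at h₂
  refine diagonal_injective ((under_left_injective h₁).symm.trans ?_)
  rw [under_self] at h₂ ⊢
  exact over_left_injective h₂

theorem diagonal_surjective (a : X) : ∃ x : X, x ▹ᵤ x = a := by
  obtain ⟨⟨x, y⟩, h⟩ := (switch_bijective (X := X)).2 (a, a)
  obtain ⟨h₁, h₂⟩ := Prod.mk.inj h
  obtain rfl : x = y := eq_of_under_eq_over (h₂.trans h₁.symm)
  exact ⟨x, h₂⟩

namespace CrossRel

theorem unique_left {x y x' y' p q : X} (h : CrossRel x y x' y') (h' : CrossRel x y p q) :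
    x' = p ∧ y' = q :=
  ⟨h.1.trans h'.1.symm, h.2.trans h'.2.symm⟩

theorem unique_right {x y x' y' p q : X} (h : CrossRel x y x' y') (h' : CrossRel p q x' y') :
    x = p ∧ y = q :=
  switch_injective (h.1.symm.trans h'.1) (h.2.symm.trans h'.2)

theorem unique_under {x y x' y' p q : X} (h : CrossRel x y x' y') (h' : CrossRel x p q y') :
    y = p ∧ x' = q := by
  obtain rfl := over_left_injective (h.2.symm.trans h'.2)
  exact ⟨rfl, h.1.trans h'.1.symm⟩

theorem unique_over {x y x' y' p q : X} (h : CrossRel x y x' y') (h' : CrossRel p y x' q) :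
    x = p ∧ y' = q := by
  obtain rfl := under_left_injective (h.1.symm.trans h'.1)
  exact ⟨rfl, h.2.trans h'.2.symm⟩

theorem exists_left (x y : X) : ∃ x' y', CrossRel x y x' y' := ⟨_, _, rfl, rfl⟩

theorem exists_right (x' y' : X) : ∃ x y, CrossRel x y x' y' := by
  obtain ⟨⟨x, y⟩, h⟩ := (switch_bijective (X := X)).2 (y', x')
  exact ⟨x, y, (Prod.mk.inj h).2.symm, (Prod.mk.inj h).1.symm⟩

theorem exists_under (x y' : X) : ∃ y x', CrossRel x y x' y' := by
  obtain ⟨y, rfl⟩ := (over_bijective x).2 y'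
  exact ⟨y, _, rfl, rfl⟩

theorem exists_over (y x' : X) : ∃ x y', CrossRel x y x' y' := by
  obtain ⟨x, rfl⟩ := (under_bijective y).2 x'
  exact ⟨x, _, rfl, rfl⟩

/-! The Yang–Baxter cube: three strands, colored `x`, `m`, `z` from the lowest to the highest one,
give twelve colored edges and six faces, one for every pair of strands and each side of the third
strand. Three faces around a corner of the cube determine the faces around the opposite corner.
The name of a lemma lists the given faces of the pairs `xm`, `xz`, `mz`, where `0` and `1` stand
for the left and the right side of the third strand. -/

variable {x₀ x₁ x₂ x₃ m₀ m₁ m₂ m₃ z₀ z₁ z₂ z₃ : X}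

theorem cube_000 (h₁ : CrossRel x₀ m₀ x₁ m₁) (h₂ : CrossRel x₀ z₀ x₂ z₁)
    (h₃ : CrossRel m₀ z₀ m₂ z₂) : ∃ x₃ m₃ z₃,
      CrossRel x₂ m₂ x₃ m₃ ∧ CrossRel x₁ z₂ x₃ z₃ ∧ CrossRel m₁ z₁ m₃ z₃ := by
  obtain ⟨rfl, rfl⟩ := h₁
  obtain ⟨rfl, rfl⟩ := h₂
  obtain ⟨rfl, rfl⟩ := h₃
  exact ⟨_, _, _, ⟨rfl, rfl⟩, ⟨exchange_uu _ _ _, rfl⟩, exchange_uo _ _ _,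
    (exchange_oo _ _ _).symm⟩

theorem cube_100 (h₁ : CrossRel x₂ m₂ x₃ m₃) (h₂ : CrossRel x₀ z₀ x₂ z₁)
    (h₃ : CrossRel m₀ z₀ m₂ z₂) : ∃ x₁ m₁ z₃,
      CrossRel x₀ m₀ x₁ m₁ ∧ CrossRel x₁ z₂ x₃ z₃ ∧ CrossRel m₁ z₁ m₃ z₃ := by
  obtain ⟨_, _, k₁⟩ := exists_left x₀ m₀
  obtain ⟨_, _, _, l₁, l₂, l₃⟩ := cube_000 k₁ h₂ h₃
  obtain ⟨rfl, rfl⟩ := l₁.unique_left h₁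
  exact ⟨_, _, _, k₁, l₂, l₃⟩

theorem cube_010 (h₁ : CrossRel x₀ m₀ x₁ m₁) (h₂ : CrossRel x₁ z₂ x₃ z₃)
    (h₃ : CrossRel m₀ z₀ m₂ z₂) : ∃ x₂ m₃ z₁,
      CrossRel x₂ m₂ x₃ m₃ ∧ CrossRel x₀ z₀ x₂ z₁ ∧ CrossRel m₁ z₁ m₃ z₃ := by
  obtain ⟨_, _, k₂⟩ := exists_left x₀ z₀
  obtain ⟨_, _, _, l₁, l₂, l₃⟩ := cube_000 h₁ k₂ h₃
  obtain ⟨rfl, rfl⟩ := l₂.unique_left h₂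
  exact ⟨_, _, _, l₁, k₂, l₃⟩

theorem cube_001 (h₁ : CrossRel x₀ m₀ x₁ m₁) (h₂ : CrossRel x₀ z₀ x₂ z₁)
    (h₃ : CrossRel m₁ z₁ m₃ z₃) : ∃ x₃ m₂ z₂,
      CrossRel x₂ m₂ x₃ m₃ ∧ CrossRel x₁ z₂ x₃ z₃ ∧ CrossRel m₀ z₀ m₂ z₂ := by
  obtain ⟨_, _, k₃⟩ := exists_left m₀ z₀
  obtain ⟨_, _, _, l₁, l₂, l₃⟩ := cube_000 h₁ h₂ k₃
  obtain ⟨rfl, rfl⟩ := l₃.unique_left h₃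
  exact ⟨_, _, _, l₁, l₂, k₃⟩

theorem cube_011 (h₁ : CrossRel x₀ m₀ x₁ m₁) (h₂ : CrossRel x₁ z₂ x₃ z₃)
    (h₃ : CrossRel m₁ z₁ m₃ z₃) : ∃ x₂ m₂ z₀,
      CrossRel x₂ m₂ x₃ m₃ ∧ CrossRel x₀ z₀ x₂ z₁ ∧ CrossRel m₀ z₀ m₂ z₂ := by
  obtain ⟨_, _, k₃⟩ := exists_under m₀ z₂
  obtain ⟨_, _, _, l₁, l₂, l₃⟩ := cube_010 h₁ h₂ k₃
  obtain ⟨rfl, rfl⟩ := l₃.unique_under h₃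
  exact ⟨_, _, _, l₁, l₂, k₃⟩

theorem cube_101 (h₁ : CrossRel x₂ m₂ x₃ m₃) (h₂ : CrossRel x₀ z₀ x₂ z₁)
    (h₃ : CrossRel m₁ z₁ m₃ z₃) : ∃ x₁ m₀ z₂,
      CrossRel x₀ m₀ x₁ m₁ ∧ CrossRel x₁ z₂ x₃ z₃ ∧ CrossRel m₀ z₀ m₂ z₂ := by
  obtain ⟨_, _, k₃⟩ := exists_over z₀ m₂
  obtain ⟨_, _, _, l₁, l₂, l₃⟩ := cube_100 h₁ h₂ k₃
  obtain ⟨rfl, rfl⟩ := l₃.unique_over h₃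
  exact ⟨_, _, _, l₁, l₂, k₃⟩

theorem cube_110 (h₁ : CrossRel x₂ m₂ x₃ m₃) (h₂ : CrossRel x₁ z₂ x₃ z₃)
    (h₃ : CrossRel m₀ z₀ m₂ z₂) : ∃ x₀ m₁ z₁,
      CrossRel x₀ m₀ x₁ m₁ ∧ CrossRel x₀ z₀ x₂ z₁ ∧ CrossRel m₁ z₁ m₃ z₃ := by
  obtain ⟨_, _, k₂⟩ := exists_over z₀ x₂
  obtain ⟨_, _, _, l₁, l₂, l₃⟩ := cube_100 h₁ k₂ h₃
  obtain ⟨rfl, rfl⟩ := l₂.unique_over h₂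
  exact ⟨_, _, _, l₁, k₂, l₃⟩

theorem cube_111 (h₁ : CrossRel x₂ m₂ x₃ m₃) (h₂ : CrossRel x₁ z₂ x₃ z₃)
    (h₃ : CrossRel m₁ z₁ m₃ z₃) : ∃ x₀ m₀ z₀,
      CrossRel x₀ m₀ x₁ m₁ ∧ CrossRel x₀ z₀ x₂ z₁ ∧ CrossRel m₀ z₀ m₂ z₂ := by
  obtain ⟨_, _, k₁⟩ := exists_right x₁ m₁
  obtain ⟨_, _, _, l₁, l₂, l₃⟩ := cube_011 k₁ h₂ h₃
  obtain ⟨rfl, rfl⟩ := l₁.unique_right h₁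
  exact ⟨_, _, _, k₁, l₂, l₃⟩

end CrossRel

/-- The coloring rule at a crossing, in terms of the colors at its four ports and of the directions
of the strands: `s` and `t` say that the under-strand is directed from port `0` to port `2` and
that the over-strand is directed from port `1` to port `3`. -/
def CrossingRule : Bool → Bool → X → X → X → X → Prop
  | true, true, a, b, c, d => CrossRel a d c b
  | true, false, a, b, c, d => CrossRel c d a b
  | false, true, a, b, c, d => CrossRel a b c d
  | false, false, a, b, c, d => CrossRel c b a d

namespace CrossingRule

variable {s t : Bool} {a b c d a' b' c' d' : X}

theorem unique₀₁ (h : CrossingRule s t a b c d) (h' : CrossingRule s t a b c' d') :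
    c = c' ∧ d = d' := by
  cases s <;> cases t
  · exact h.unique_over h'
  · exact h.unique_left h'
  · exact h.unique_right h'
  · exact (h.unique_under h').symm

theorem unique₁₂ (h : CrossingRule s t a b c d) (h' : CrossingRule s t a' b c d') :
    a = a' ∧ d = d' := by
  cases s <;> cases t
  · exact h.unique_left h'
  · exact h.unique_over h'
  · exact (h.unique_under h').symm
  · exact h.unique_right h'

theorem unique₂₃ (h : CrossingRule s t a b c d) (h' : CrossingRule s t a' b' c d) :
    a = a' ∧ b = b' := by
  cases s <;> cases t
  · exact (h.unique_under h').symm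
  · exact h.unique_right h'
  · exact h.unique_left h'
  · exact h.unique_over h'

theorem exists₀₁ (s t : Bool) (a b : X) : ∃ c d, CrossingRule s t a b c d := by
  cases s <;> cases t
  · exact CrossRel.exists_over b a
  · exact CrossRel.exists_left a b
  · exact CrossRel.exists_right a b
  · obtain ⟨d, c, h⟩ := CrossRel.exists_under a b
    exact ⟨c, d, h⟩

theorem exists₂₃ (s t : Bool) (c d : X) : ∃ a b, CrossingRule s t a b c d := by
  cases s <;> cases t
  · obtain ⟨b, a, h⟩ := CrossRel.exists_under c d
    exact ⟨a, b, h⟩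
  · exact CrossRel.exists_right c d
  · exact CrossRel.exists_left c d
  · exact CrossRel.exists_over d c

end CrossingRule

end Crossings

section Products

variable {X : Type u} [PartiallyMultiplicativeBiquandle X] {a b c d e u v x y : X}

open Biquandle PartiallyMultiplicativeBiquandle

namespace IsProd

theorem unique (h : IsProd a b c) (h' : IsProd a b d) : c = d := by
  obtain ⟨_, rfl⟩ := h
  obtain ⟨_, rfl⟩ := h'
  rfl

theorem left_cancel (h : IsProd a x c) (h' : IsProd a y c) : x = y :=
  mul_left_injective a x y h.1 h'.1 (h.2.trans h'.2.symm)

theorem right_cancel (h : IsProd x b c) (h' : IsProd y b c) : x = y :=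
  mul_right_injective b x y h.1 h'.1 (h.2.trans h'.2.symm)

theorem swap_iff : IsProd a (b ▹ᵤ a) c ↔ IsProd b (a ▹ₒ b) c := by
  constructor
  · rintro ⟨h, rfl⟩
    exact ⟨(D_swap a b).1 h, (mul_swap a b _ _).symm⟩
  · rintro ⟨h, rfl⟩
    exact ⟨(D_swap a b).2 h, mul_swap a b _ _⟩

theorem under_iff (x : X) :
    IsProd (a ▹ᵤ x) (b ▹ᵤ (x ▹ₒ a)) (c ▹ᵤ x) ↔ IsProd a b c := by
  constructor
  · rintro ⟨h, hc⟩
    have h' := (D_under a b x).2 h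
    exact ⟨h', under_left_injective ((mul_under a b x h' h).trans hc)⟩
  · rintro ⟨h, rfl⟩
    exact ⟨(D_under a b x).1 h, (mul_under a b x _ _).symm⟩

theorem over_iff (x : X) :
    IsProd (a ▹ₒ x) (b ▹ₒ (x ▹ᵤ a)) (c ▹ₒ x) ↔ IsProd a b c := by
  constructor
  · rintro ⟨h, hc⟩
    have h' := (D_over a b x).2 h
    exact ⟨h', over_left_injective ((mul_over a b x h' h).trans hc)⟩
  · rintro ⟨h, rfl⟩
    exact ⟨(D_over a b x).1 h, (mul_over a b x _ _).symm⟩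

theorem under_act (h : IsProd a b c) (x : X) : x ▹ᵤ c = x ▹ᵤ a ▹ᵤ b := by
  obtain ⟨h, rfl⟩ := h
  exact under_mul a b x h

theorem over_act (h : IsProd a b c) (x : X) : x ▹ₒ c = x ▹ₒ a ▹ₒ b := by
  obtain ⟨h, rfl⟩ := h
  exact over_mul a b x h

theorem assoc (h : IsProd a b d) (h' : IsProd d c e) : ∃ p, IsProd b c p ∧ IsProd a p e := by
  obtain ⟨h, rfl⟩ := h
  obtain ⟨h', rfl⟩ := h'
  obtain ⟨k, k'⟩ := (D_assoc a b c).1 ⟨h, h'⟩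
  exact ⟨_, ⟨k, rfl⟩, k', (PartiallyMultiplicativeBiquandle.mul_assoc a b c _ _ _ _).symm⟩

theorem assoc_symm (h : IsProd b c d) (h' : IsProd a d e) :
    ∃ p, IsProd a b p ∧ IsProd p c e := by
  obtain ⟨h, rfl⟩ := h
  obtain ⟨h', rfl⟩ := h'
  obtain ⟨k, k'⟩ := (D_assoc a b c).2 ⟨h, h'⟩
  exact ⟨_, ⟨k, rfl⟩, k', PartiallyMultiplicativeBiquandle.mul_assoc a b c _ _ _ _⟩

theorem exists_of_eq (h : IsProd a b x) (h' : IsProd c d x) :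
    ∃ e, IsProd a e c ∧ IsProd e d b := by
  obtain ⟨h, rfl⟩ := h
  obtain ⟨e, k, k', l, l'⟩ := (mul_eq_mul_iff a b c d).1 ⟨h, h'.1, h'.2.symm⟩
  exact ⟨e, ⟨k, l⟩, k', l'⟩

theorem exists_unit (h : IsProd a b c) : ∃ u, IsProd a u a ∧ IsProd u b b :=
  exists_of_eq h h

theorem unit_of_right (h : IsProd a u a) : IsProd u u u := by
  obtain ⟨p, h₁, h₂⟩ := h.assoc h
  rwa [← h.left_cancel h₂] at h₁

theorem unit_of_left (h : IsProd u b b) : IsProd u u u := by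
  obtain ⟨p, h₁, h₂⟩ := h.assoc_symm h
  rwa [← h.right_cancel h₂] at h₁

theorem unit_under_act (h : IsProd u u u) (x : X) : x ▹ᵤ u = x :=
  under_left_injective (h.under_act x).symm

theorem unit_over_act (h : IsProd u u u) (x : X) : x ▹ₒ u = x :=
  over_left_injective (h.over_act x).symm

theorem unit_under (h : IsProd u u u) (x : X) : IsProd (u ▹ᵤ x) (u ▹ᵤ x) (u ▹ᵤ x) := by
  have := (under_iff x).2 h
  rwa [h.unit_over_act] at this

theorem unit_over (h : IsProd u u u) (x : X) : IsProd (u ▹ₒ x) (u ▹ₒ x) (u ▹ₒ x) := by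
  have := (over_iff x).2 h
  rwa [h.unit_under_act] at this

theorem eq_of_unit_right (hu : IsProd u u u) (h : IsProd a u b) : b = a := by
  obtain ⟨p, h₁, h₂⟩ := hu.assoc_symm h
  obtain rfl := h.unique h₁
  exact h₂.right_cancel h

theorem exists_right_unit (h : IsProd u b b) : ∃ v, IsProd b v b := by
  refine ⟨u ▹ₒ b, swap_iff.1 ?_⟩
  rwa [h.unit_of_left.unit_under_act]

theorem exists_left_unit (h : IsProd b v b) : ∃ u, IsProd u b b := by
  have hv := h.unit_of_right
  obtain ⟨u, rfl⟩ := (over_bijective b).2 v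
  have h₁ : IsProd u (b ▹ᵤ u) b := swap_iff.2 h
  obtain ⟨w, h₂, -⟩ := h₁.exists_unit
  have hw := h₂.unit_of_right
  have h₃ : w ▹ₒ (b ▹ᵤ u) = u ▹ₒ b := ((over_iff b).2 h₂).left_cancel hv
  have h₄ := exchange_uo u u b
  rw [hv.unit_under_act, ← h₃] at h₄
  have h₅ : u ▹ᵤ u = w ▹ᵤ w := by rw [hw.unit_under_act, over_left_injective h₄]
  obtain rfl := diagonal_injective h₅
  rw [hw.unit_under_act] at h₁
  exact ⟨u, h₁⟩

end IsProd

/-- The elements which occur in products. -/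
def IsFactor (a : X) : Prop := ∃ u, IsProd a u a

theorem IsFactor.exists_inv (h : IsFactor a) :
    ∃ e u w, IsProd a u a ∧ IsProd w a a ∧ IsProd a e w ∧ IsProd e a u := by
  obtain ⟨u, hu⟩ := h
  obtain ⟨w, hw⟩ := hu.exists_left_unit
  obtain ⟨e, h₁, h₂⟩ := hu.exists_of_eq hw
  exact ⟨e, u, w, hu, hw, h₁, h₂⟩

open Classical in
/-- The inverse of a factor with respect to the partial multiplication; other elements are their
own inverses by convention. -/
noncomputable def pinv (a : X) : X := if h : IsFactor a then h.exists_inv.choose else a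

theorem IsFactor.pinv_spec (h : IsFactor a) :
    ∃ u w, IsProd a u a ∧ IsProd w a a ∧ IsProd a (pinv a) w ∧ IsProd (pinv a) a u := by
  rw [pinv, dif_pos h]
  exact h.exists_inv.choose_spec

theorem pinv_of_not_isFactor (h : ¬ IsFactor a) : pinv a = a := dif_neg h

namespace IsProd

theorem isFactor_left (h : IsProd a b c) : IsFactor a :=
  h.exists_unit.imp fun _ h => h.1

theorem isFactor_right (h : IsProd a b c) : IsFactor b :=
  h.exists_unit.elim fun _ h => h.2.exists_right_unit

theorem pinv_left (h : IsProd a b c) : IsProd (pinv a) c b := by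
  obtain ⟨u, w, h₁, -, -, h₂⟩ := h.isFactor_left.pinv_spec
  obtain ⟨v, h₃, h₄⟩ := h.exists_unit
  obtain rfl := h₁.left_cancel h₃
  obtain ⟨p, h₅, h₆⟩ := h₂.assoc h₄
  rwa [h.unique h₅]

theorem pinv_right (h : IsProd a b c) : IsProd c (pinv b) a := by
  obtain ⟨u, w, -, h₁, h₂, -⟩ := h.isFactor_right.pinv_spec
  obtain ⟨v, h₃, h₄⟩ := h.exists_unit
  obtain rfl := h₁.right_cancel h₄
  obtain ⟨p, h₅, h₆⟩ := h₂.assoc_symm h₃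
  rwa [h.unique h₅]

theorem isFactor (h : IsProd a b c) : IsFactor c := h.pinv_right.isFactor_left

theorem pinv_eq (h : IsProd a b u) (hu : IsProd u u u) : pinv a = b :=
  (eq_of_unit_right hu h.pinv_left).symm

end IsProd

@[simp]
theorem pinv_pinv (a : X) : pinv (pinv a) = a := by
  by_cases h : IsFactor a
  · obtain ⟨u, w, h₁, -, -, h₂⟩ := h.pinv_spec
    exact h₂.pinv_eq h₁.unit_of_right
  · rw [pinv_of_not_isFactor h, pinv_of_not_isFactor h]

theorem IsFactor.pinv (h : IsFactor a) : IsFactor (pinv a) := by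
  obtain ⟨_, _, -, -, h, -⟩ := h.pinv_spec
  exact h.isFactor_right

theorem IsFactor.under (h : IsFactor a) (x : X) : IsFactor (a ▹ᵤ x) := by
  obtain ⟨_, h⟩ := h
  exact ⟨_, (IsProd.under_iff x).2 h⟩

theorem IsFactor.over (h : IsFactor a) (x : X) : IsFactor (a ▹ₒ x) := by
  obtain ⟨_, h⟩ := h
  exact ⟨_, (IsProd.over_iff x).2 h⟩

theorem IsFactor.of_under (h : IsFactor (a ▹ᵤ x)) : IsFactor a := by
  obtain ⟨u, h⟩ := h
  obtain ⟨v, rfl⟩ := (under_bijective (x ▹ₒ a)).2 u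
  exact ⟨v, (IsProd.under_iff x).1 h⟩

theorem IsFactor.of_over (h : IsFactor (a ▹ₒ x)) : IsFactor a := by
  obtain ⟨u, h⟩ := h
  obtain ⟨v, rfl⟩ := (over_bijective (x ▹ᵤ a)).2 u
  exact ⟨v, (IsProd.over_iff x).1 h⟩

theorem CrossRel.pinv_over {x y x' y' : X} (h : CrossRel x y x' y') (hy : IsFactor y) :
    CrossRel x' (pinv y) x (pinv y') := by
  obtain ⟨rfl, rfl⟩ := h
  obtain ⟨u, w, -, h₁, h₂, -⟩ := hy.pinv_spec
  refine ⟨?_, ?_⟩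
  · rw [← h₂.under_act, h₁.unit_of_left.unit_under_act]
  · exact ((IsProd.over_iff x).2 h₂).pinv_eq (h₁.unit_of_left.unit_over x)

theorem CrossRel.pinv_under {x y x' y' : X} (h : CrossRel x y x' y') (hx : IsFactor x) :
    CrossRel (pinv x) y' (pinv x') y := by
  obtain ⟨rfl, rfl⟩ := h
  obtain ⟨u, w, -, h₁, h₂, -⟩ := hx.pinv_spec
  refine ⟨?_, ?_⟩
  · exact ((IsProd.under_iff y).2 h₂).pinv_eq (h₁.unit_of_left.unit_under y)
  · rw [← h₂.over_act, h₁.unit_of_left.unit_over_act]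

theorem CrossRel.isFactor_under {x y x' y' : X} (h : CrossRel x y x' y') :
    IsFactor x' ↔ IsFactor x := by
  obtain ⟨rfl, rfl⟩ := h
  exact ⟨IsFactor.of_under, fun h => h.under y⟩

theorem CrossRel.isFactor_over {x y x' y' : X} (h : CrossRel x y x' y') :
    IsFactor y' ↔ IsFactor y := by
  obtain ⟨rfl, rfl⟩ := h
  exact ⟨IsFactor.of_over, fun h => h.over x⟩

/-- The color of an edge read in the direction given by `b`. -/
noncomputable def signed (b : Bool) (a : X) : X := if b then a else pinv a

@[simp] theorem signed_true (a : X) : signed true a = a := rfl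

@[simp] theorem signed_false (a : X) : signed false a = pinv a := rfl

@[simp] theorem signed_signed (b : Bool) (a : X) : signed b (signed b a) = a := by
  cases b <;> simp

@[simp] theorem signed_not (b : Bool) (a : X) : signed (!b) a = pinv (signed b a) := by
  cases b <;> simp

theorem signed_injective (b : Bool) : Function.Injective (signed b : X → X) :=
  Function.LeftInverse.injective (signed_signed b)

theorem IsFactor.signed (h : IsFactor a) (b : Bool) : IsFactor (signed b a) := by
  cases b
  exacts [h.pinv, h]

theorem isFactor_signed {b : Bool} : IsFactor (signed b a) ↔ IsFactor a :=
  ⟨fun h => by simpa using h.signed b, fun h => h.signed b⟩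

namespace CrossingRule

variable {s t : Bool}

theorem isFactor_under (h : CrossingRule s t a b c d) : IsFactor c ↔ IsFactor a := by
  cases s <;> cases t
  exacts [h.isFactor_under.symm, h.isFactor_under, h.isFactor_under.symm, h.isFactor_under]

theorem isFactor_over (h : CrossingRule s t a b c d) : IsFactor d ↔ IsFactor b := by
  cases s <;> cases t
  exacts [h.isFactor_over, h.isFactor_over, h.isFactor_over.symm, h.isFactor_over.symm]

theorem pinv_under (h : CrossingRule s t a b c d) (ha : IsFactor a) :
    CrossingRule (!s) t (pinv a) b (pinv c) d := by
  have hc := h.isFactor_under.2 ha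
  cases s <;> cases t <;> first | exact CrossRel.pinv_under h ha | exact CrossRel.pinv_under h hc

theorem pinv_over (h : CrossingRule s t a b c d) (hb : IsFactor b) :
    CrossingRule s (!t) a (pinv b) c (pinv d) := by
  have hd := h.isFactor_over.2 hb
  cases s <;> cases t <;> first | exact CrossRel.pinv_over h hb | exact CrossRel.pinv_over h hd

theorem signed_under (r : Bool) (ha : IsFactor a) :
    CrossingRule (s == r) t (signed r a) b (signed r c) d ↔ CrossingRule s t a b c d := by
  cases r
  · refine ⟨fun h => ?_, fun h => ?_⟩
    · simpa using h.pinv_under ha.pinv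
    · simpa using h.pinv_under ha
  · simp

theorem signed_over (r : Bool) (hb : IsFactor b) :
    CrossingRule s (t == r) a (signed r b) c (signed r d) ↔ CrossingRule s t a b c d := by
  cases r
  · refine ⟨fun h => ?_, fun h => ?_⟩
    · simpa using h.pinv_over hb.pinv
    · simpa using h.pinv_over hb
  · simp

end CrossingRule

/-- The coloring rule at a vertex, in terms of the colors at its three ports, where the edges
are read in the direction towards the vertex. -/
def VertexRule (x y z : X) : Prop := IsProd x y (pinv z)

namespace VertexRule

variable {z w : X}

theorem rotate (h : VertexRule x y z) : VertexRule y z x := by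
  simpa [VertexRule] using (IsProd.pinv_left h).pinv_right

theorem reverse_iff : VertexRule x y z ↔ IsProd (pinv z) (pinv y) x := by
  refine ⟨IsProd.pinv_right, fun h => ?_⟩
  simpa [VertexRule] using IsProd.pinv_right h

theorem exchange (h : VertexRule x y e) (h' : VertexRule (pinv e) z w) :
    ∃ f, VertexRule w x f ∧ VertexRule (pinv f) y z := by
  obtain ⟨f, h₁, h₂⟩ := IsProd.assoc h h'
  refine ⟨f, VertexRule.rotate (VertexRule.rotate h₂), (VertexRule.rotate (VertexRule.rotate ?_))⟩
  simpa [VertexRule] using h₁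

theorem unique (h : VertexRule x y z) (h' : VertexRule x y w) : z = w := by
  rw [← pinv_pinv z, IsProd.unique h h', pinv_pinv]

end VertexRule

end Products

namespace Picture

variable {n : ℕ} {P Q : Picture n} {X : Type u} [PartiallyMultiplicativeBiquandle X]

theorem vertex_rules_iff (b : Fin 3 → Bool) (a : Fin 3 → X)
    (h : (∃ i, b i = true) ∧ ∃ i, b i = false) :
    ((∀ i, b (i + 1) = true → b (i + 2) = true → b i = false →
        IsProd (a (i + 1)) (a (i + 2)) (a i)) ∧
      ∀ i, b (i + 1) = false → b (i + 2) = false → b i = true →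
        IsProd (a (i + 2)) (a (i + 1)) (a i)) ↔
      VertexRule (signed (b 0) (a 0)) (signed (b 1) (a 1)) (signed (b 2) (a 2)) := by
  have rot : ∀ x y z : X, VertexRule x y z ↔ VertexRule y z x := fun x y z =>
    ⟨VertexRule.rotate, fun h => h.rotate.rotate⟩
  have e₁ : (1 : Fin 3) + 2 = 0 := rfl
  have e₂ : (2 : Fin 3) + 2 = 1 := rfl
  have e₃ : (1 : Fin 3) + 1 = 2 := rfl
  have e₄ : (2 : Fin 3) + 1 = 0 := rfl
  simp only [Fin.exists_fin_succ, Fin.forall_fin_succ, Fin.succ_zero_eq_one, IsEmpty.exists_iff,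
    Fin.succ_one_eq_two, IsEmpty.forall_iff, zero_add, e₁, e₂, e₃, e₄] at h ⊢
  generalize b 0 = b₀ at *
  generalize b 1 = b₁ at *
  generalize b 2 = b₂ at *
  cases b₀ <;> cases b₁ <;> cases b₂ <;> simp at h ⊢
  · rw [rot, rot, VertexRule.reverse_iff, pinv_pinv, pinv_pinv]
  · rw [rot, VertexRule.reverse_iff, pinv_pinv, pinv_pinv]
  · rw [rot, VertexRule, pinv_pinv]
  · rw [VertexRule.reverse_iff, pinv_pinv, pinv_pinv]
  · rw [rot, rot, VertexRule, pinv_pinv]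
  · rw [VertexRule, pinv_pinv]

namespace YOrientation

theorem inC_add_two (o : P.YOrientation) (c : P.C) (i : Fin 4) :
    o.inC c (i + 2) = !o.inC c i :=
  Bool.eq_not.2 (o.crossing_dir c i).symm

theorem crossing_rules_iff (o : P.YOrientation) (f : P.E → X) (c : P.C) :
    (f (P.arcC c (o.leftUnder c + 2)) =
        Biquandle.passUnder (f (P.arcC c (o.leftUnder c))) (f (P.arcC c (o.leftOver c))) ∧
      f (P.arcC c (o.leftOver c + 2)) =
        Biquandle.passOver (f (P.arcC c (o.leftOver c))) (f (P.arcC c (o.leftUnder c)))) ↔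
    CrossingRule (o.inC c 0) (o.inC c 1) (f (P.arcC c 0)) (f (P.arcC c 1)) (f (P.arcC c 2))
      (f (P.arcC c 3)) := by
  unfold leftUnder leftOver
  cases o.inC c 0 <;> cases o.inC c 1 <;> exact Iff.rfl

theorem isColoring_iff (o : P.YOrientation) (f : P.E → X) : o.IsColoring f ↔
    (∀ c, CrossingRule (o.inC c 0) (o.inC c 1) (f (P.arcC c 0)) (f (P.arcC c 1)) (f (P.arcC c 2))
      (f (P.arcC c 3))) ∧
    ∀ v, VertexRule (signed (o.inV v 0) (f (P.arcV v 0))) (signed (o.inV v 1) (f (P.arcV v 1)))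
      (signed (o.inV v 2) (f (P.arcV v 2))) := by
  refine ⟨fun h => ⟨fun c => ?_, fun v => ?_⟩, fun h => ?_⟩
  · exact (o.crossing_rules_iff f c).1 ⟨h.under_rule c, h.over_rule c⟩
  · exact (vertex_rules_iff (o.inV v) (fun i => f (P.arcV v i)) (o.vertex_dir v)).1
      ⟨h.merge v, h.split v⟩
  · have hc := fun c => (o.crossing_rules_iff f c).2 (h.1 c)
    have hv := fun v =>
      (vertex_rules_iff (o.inV v) (fun i => f (P.arcV v i)) (o.vertex_dir v)).2 (h.2 v)
    exact ⟨fun c => (hc c).1, fun c => (hc c).2, fun v => (hv v).1, fun v => (hv v).2⟩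

theorem inward_arc (o : P.YOrientation) {p q : Port P.C P.V n} (h : p ≠ q)
    (h' : P.arc p = P.arc q) : o.inward p = !o.inward q :=
  Bool.eq_not.2 (o.arc_dir p q h h')

end YOrientation

/-- Every coloring of `P` can be replaced by a coloring of `Q` with the same boundary colors. -/
def Transfers (P Q : Picture n) (X : Type u) [PartiallyMultiplicativeBiquandle X] : Prop :=
  ∀ (o : P.YOrientation) (o' : Q.YOrientation), (∀ i, o.inB i = o'.inB i) →
    ∀ f : P.E → X, o.IsColoring f →
      ∃ g : Q.E → X, o'.IsColoring g ∧ ∀ i, g (Q.arcB i) = f (P.arcB i)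

/-- The colorings of `P` are determined by their boundary colors. -/
def Rigid (P : Picture n) (X : Type u) [PartiallyMultiplicativeBiquandle X] : Prop :=
  ∀ (o : P.YOrientation) (f g : P.E → X), o.IsColoring f → o.IsColoring g →
    (∀ i, f (P.arcB i) = g (P.arcB i)) → f = g

theorem crossingRule_congr {s t s' t' : Bool} (hs : s = s') (ht : t = t') {a b c d : X} :
    CrossingRule s t a b c d ↔ CrossingRule s' t' a b c d := by
  rw [hs, ht]

theorem vertexRule_congr {r s t r' s' t' : Bool} (hr : r = r') (hs : s = s') (ht : t = t')
    {a b c : X} : VertexRule (signed r a) (signed s b) (signed t c) ↔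
      VertexRule (signed r' a) (signed s' b) (signed t' c) := by
  rw [hr, hs, ht]

theorem forall_fin_three {p : Fin 3 → Prop} : (∀ i, p i) ↔ p 0 ∧ p 1 ∧ p 2 := by
  simp [Fin.forall_fin_succ]

theorem threeL_isColoring_iff (o : threeL.YOrientation) (f : Fin 9 → X) : o.IsColoring f ↔
    CrossingRule (!o.inB 0) (!o.inB 2) (f 6) (f 2) (f 3) (f 8) ∧
    CrossingRule (!o.inB 0) (!o.inB 1) (f 0) (f 1) (f 6) (f 7) ∧
    CrossingRule (!o.inB 1) (!o.inB 2) (f 7) (f 8) (f 4) (f 5) := by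
  have e₁ : o.inC (1 : Fin 3) 0 = !o.inB 0 := o.inward_arc (by nofun) rfl
  have e₂ : o.inC (1 : Fin 3) 1 = !o.inB 1 := o.inward_arc (by nofun) rfl
  have e₃ : o.inC (0 : Fin 3) 1 = !o.inB 2 := o.inward_arc (by nofun) rfl
  have e₄ : o.inC (0 : Fin 3) 0 = !o.inC (1 : Fin 3) 2 := o.inward_arc (by nofun) rfl
  have e₅ : o.inC (1 : Fin 3) 2 = !o.inC (1 : Fin 3) 0 := o.inC_add_two _ 0
  have e₆ : o.inC (2 : Fin 3) 0 = !o.inC (1 : Fin 3) 3 := o.inward_arc (by nofun) rfl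
  have e₇ : o.inC (1 : Fin 3) 3 = !o.inC (1 : Fin 3) 1 := o.inC_add_two _ 1
  have e₈ : o.inC (2 : Fin 3) 1 = !o.inC (0 : Fin 3) 3 := o.inward_arc (by nofun) rfl
  have e₉ : o.inC (0 : Fin 3) 3 = !o.inC (0 : Fin 3) 1 := o.inC_add_two _ 1
  rw [e₅, e₁, Bool.not_not] at e₄
  rw [e₇, e₂, Bool.not_not] at e₆
  rw [e₉, e₃, Bool.not_not] at e₈
  exact (o.isColoring_iff f).trans <| (and_iff_left (by nofun)).trans <|
    forall_fin_three.trans <| and_congr (crossingRule_congr e₄ e₃) <|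
    and_congr (crossingRule_congr e₁ e₂) (crossingRule_congr e₆ e₈)
theorem threeR_isColoring_iff (o : threeR.YOrientation) (f : Fin 9 → X) : o.IsColoring f ↔
    CrossingRule (!o.inB 0) (!o.inB 2) (f 0) (f 8) (f 6) (f 5) ∧
    CrossingRule (!o.inB 0) (!o.inB 1) (f 6) (f 7) (f 3) (f 4) ∧
    CrossingRule (!o.inB 1) (!o.inB 2) (f 1) (f 2) (f 7) (f 8) := by
  have e₁ : o.inC (0 : Fin 3) 0 = !o.inB 0 := o.inward_arc (by nofun) rfl
  have e₂ : o.inC (2 : Fin 3) 0 = !o.inB 1 := o.inward_arc (by nofun) rfl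
  have e₃ : o.inC (2 : Fin 3) 1 = !o.inB 2 := o.inward_arc (by nofun) rfl
  have e₄ : o.inC (0 : Fin 3) 1 = !o.inC (2 : Fin 3) 3 := o.inward_arc (by nofun) rfl
  have e₅ : o.inC (2 : Fin 3) 3 = !o.inC (2 : Fin 3) 1 := o.inC_add_two _ 1
  have e₆ : o.inC (1 : Fin 3) 0 = !o.inC (0 : Fin 3) 2 := o.inward_arc (by nofun) rfl
  have e₇ : o.inC (0 : Fin 3) 2 = !o.inC (0 : Fin 3) 0 := o.inC_add_two _ 0
  have e₈ : o.inC (1 : Fin 3) 1 = !o.inC (2 : Fin 3) 2 := o.inward_arc (by nofun) rfl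
  have e₉ : o.inC (2 : Fin 3) 2 = !o.inC (2 : Fin 3) 0 := o.inC_add_two _ 0
  rw [e₅, e₃, Bool.not_not] at e₄
  rw [e₇, e₁, Bool.not_not] at e₆
  rw [e₉, e₂, Bool.not_not] at e₈
  exact (o.isColoring_iff f).trans <| (and_iff_left (by nofun)).trans <|
    forall_fin_three.trans <| and_congr (crossingRule_congr e₁ e₄) <|
    and_congr (crossingRule_congr e₆ e₈) (crossingRule_congr e₂ e₃)

theorem oneL_isColoring (o : oneL.YOrientation) (f : Fin 1 → X) : o.IsColoring f :=
  (o.isColoring_iff f).2 ⟨by nofun, by nofun⟩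

theorem oneR_isColoring_iff (o : oneR.YOrientation) (f : Fin 3 → X) : o.IsColoring f ↔
    CrossingRule (o.inB 0) (!o.inB 0) (f 0) (f 0) (f 1) (f 2) := by
  have e₁ : o.inC (0 : Fin 1) 2 = !o.inB 0 := o.inward_arc (by nofun) rfl
  have e₂ : o.inC (0 : Fin 1) 2 = !o.inC (0 : Fin 1) 0 := o.inC_add_two _ 0
  have e₃ : o.inC (0 : Fin 1) 1 = !o.inC (0 : Fin 1) 0 := o.inward_arc
    (by decide : (Sum.inl (0, 1) : Port (Fin 1) (Fin 0) 2) ≠ Sum.inl (0, 0)) rfl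
  have e₄ : o.inC (0 : Fin 1) 0 = o.inB 0 := Bool.not_inj (e₂.symm.trans e₁)
  rw [e₄] at e₃
  exact (o.isColoring_iff f).trans <| (and_iff_left (by nofun)).trans <|
    Fin.forall_fin_one.trans (crossingRule_congr e₄ e₃)

theorem twoL_isColoring (o : twoL.YOrientation) (f : Fin 2 → X) : o.IsColoring f :=
  (o.isColoring_iff f).2 ⟨by nofun, by nofun⟩

theorem twoR_isColoring_iff (o : twoR.YOrientation) (f : Fin 6 → X) : o.IsColoring f ↔
    CrossingRule (!o.inB 0) (!o.inB 1) (f 0) (f 1) (f 2) (f 3) ∧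
    CrossingRule (!o.inB 0) (o.inB 1) (f 2) (f 4) (f 5) (f 3) := by
  have e₁ : o.inC (0 : Fin 2) 0 = !o.inB 0 := o.inward_arc (by nofun) rfl
  have e₂ : o.inC (0 : Fin 2) 1 = !o.inB 1 := o.inward_arc (by nofun) rfl
  have e₃ : o.inC (1 : Fin 2) 0 = !o.inC (0 : Fin 2) 2 := o.inward_arc (by nofun) rfl
  have e₄ : o.inC (0 : Fin 2) 2 = !o.inC (0 : Fin 2) 0 := o.inC_add_two _ 0
  have e₅ : o.inC (1 : Fin 2) 3 = !o.inC (0 : Fin 2) 3 := o.inward_arc (by nofun) rfl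
  have e₆ : o.inC (0 : Fin 2) 3 = !o.inC (0 : Fin 2) 1 := o.inC_add_two _ 1
  have e₇ : o.inC (1 : Fin 2) 1 = !o.inC (1 : Fin 2) 3 := o.inC_add_two _ 3
  rw [e₄, e₁, Bool.not_not] at e₃
  rw [e₅, e₆, e₂, Bool.not_not, Bool.not_not] at e₇
  exact (o.isColoring_iff f).trans <| (and_iff_left (by nofun)).trans <|
    Fin.forall_fin_two.trans <| and_congr (crossingRule_congr e₁ e₂) (crossingRule_congr e₃ e₇)

theorem fourL_isColoring_iff (o : fourL.YOrientation) (f : Fin 3 → X) : o.IsColoring f ↔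
    VertexRule (signed (!o.inB 0) (f 0)) (signed (!o.inB 1) (f 1)) (signed (!o.inB 2) (f 2)) := by
  have e₁ : o.inV (0 : Fin 1) 0 = !o.inB 0 := o.inward_arc (by nofun) rfl
  have e₂ : o.inV (0 : Fin 1) 1 = !o.inB 1 := o.inward_arc (by nofun) rfl
  have e₃ : o.inV (0 : Fin 1) 2 = !o.inB 2 := o.inward_arc (by nofun) rfl
  exact (o.isColoring_iff f).trans <| (and_iff_right (by nofun)).trans <|
    Fin.forall_fin_one.trans (vertexRule_congr e₁ e₂ e₃)

theorem fourR_isColoring_iff (o : fourR.YOrientation) (f : Fin 5 → X) : o.IsColoring f ↔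
    CrossingRule (o.inB 1) (o.inB 2) (f 4) (f 3) (f 1) (f 2) ∧
    VertexRule (signed (!o.inB 0) (f 0)) (signed (!o.inB 2) (f 3)) (signed (!o.inB 1) (f 4)) := by
  have e₁ : o.inV (0 : Fin 1) 0 = !o.inB 0 := o.inward_arc (by nofun) rfl
  have e₂ : o.inC (0 : Fin 1) 2 = !o.inB 1 := o.inward_arc (by nofun) rfl
  have e₃ : o.inC (0 : Fin 1) 3 = !o.inB 2 := o.inward_arc (by nofun) rfl
  have e₄ : o.inC (0 : Fin 1) 0 = !o.inC (0 : Fin 1) 2 := o.inC_add_two _ 2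
  have e₅ : o.inC (0 : Fin 1) 1 = !o.inC (0 : Fin 1) 3 := o.inC_add_two _ 3
  have e₆ : o.inV (0 : Fin 1) 1 = !o.inC (0 : Fin 1) 1 := o.inward_arc (by nofun) rfl
  have e₇ : o.inV (0 : Fin 1) 2 = !o.inC (0 : Fin 1) 0 := o.inward_arc (by nofun) rfl
  rw [e₂, Bool.not_not] at e₄
  rw [e₃, Bool.not_not] at e₅
  rw [e₅] at e₆
  rw [e₄] at e₇
  exact (o.isColoring_iff f).trans <| and_congr (Fin.forall_fin_one.trans (crossingRule_congr e₄ e₅))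
    (Fin.forall_fin_one.trans (vertexRule_congr e₁ e₆ e₇))

theorem fiveL_isColoring_iff (o : fiveL.YOrientation) (f : Fin 6 → X) : o.IsColoring f ↔
    CrossingRule (!o.inB 0) (!o.inB 1) (f 0) (f 1) (f 5) (f 4) ∧
    VertexRule (signed (!o.inB 0) (f 5)) (signed (!o.inB 2) (f 2)) (signed (!o.inB 3) (f 3)) := by
  have e₁ : o.inC (0 : Fin 1) 0 = !o.inB 0 := o.inward_arc (by nofun) rfl
  have e₂ : o.inC (0 : Fin 1) 1 = !o.inB 1 := o.inward_arc (by nofun) rfl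
  have e₃ : o.inV (0 : Fin 1) 1 = !o.inB 2 := o.inward_arc (by nofun) rfl
  have e₄ : o.inV (0 : Fin 1) 2 = !o.inB 3 := o.inward_arc (by nofun) rfl
  have e₅ : o.inV (0 : Fin 1) 0 = !o.inC (0 : Fin 1) 2 := o.inward_arc (by nofun) rfl
  have e₆ : o.inC (0 : Fin 1) 2 = !o.inC (0 : Fin 1) 0 := o.inC_add_two _ 0
  rw [e₆, e₁, Bool.not_not] at e₅
  exact (o.isColoring_iff f).trans <| and_congr (Fin.forall_fin_one.trans (crossingRule_congr e₁ e₂))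
    (Fin.forall_fin_one.trans (vertexRule_congr e₅ e₃ e₄))

theorem fiveR_isColoring_iff (o : fiveR.YOrientation) (f : Fin 8 → X) : o.IsColoring f ↔
    (CrossingRule (o.inB 2) (!o.inB 1) (f 5) (f 1) (f 2) (f 7) ∧
      CrossingRule (o.inB 3) (!o.inB 1) (f 6) (f 7) (f 3) (f 4)) ∧
    VertexRule (signed (!o.inB 0) (f 0)) (signed (!o.inB 2) (f 5)) (signed (!o.inB 3) (f 6)) := by
  have e₁ : o.inC (0 : Fin 2) 2 = !o.inB 2 := o.inward_arc (by nofun) rfl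
  have e₂ : o.inC (0 : Fin 2) 1 = !o.inB 1 := o.inward_arc (by nofun) rfl
  have e₃ : o.inC (1 : Fin 2) 2 = !o.inB 3 := o.inward_arc (by nofun) rfl
  have e₄ : o.inC (0 : Fin 2) 0 = !o.inC (0 : Fin 2) 2 := o.inC_add_two _ 2
  have e₅ : o.inC (1 : Fin 2) 0 = !o.inC (1 : Fin 2) 2 := o.inC_add_two _ 2
  have e₆ : o.inC (0 : Fin 2) 3 = !o.inC (0 : Fin 2) 1 := o.inC_add_two _ 1
  have e₇ : o.inC (1 : Fin 2) 1 = !o.inC (0 : Fin 2) 3 := o.inward_arc (by nofun) rfl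
  have e₈ : o.inV (0 : Fin 1) 0 = !o.inB 0 := o.inward_arc (by nofun) rfl
  have e₉ : o.inV (0 : Fin 1) 1 = !o.inC (0 : Fin 2) 0 := o.inward_arc (by nofun) rfl
  have e₁₀ : o.inV (0 : Fin 1) 2 = !o.inC (1 : Fin 2) 0 := o.inward_arc (by nofun) rfl
  rw [e₁, Bool.not_not] at e₄
  rw [e₃, Bool.not_not] at e₅
  rw [e₆, e₂, Bool.not_not] at e₇
  rw [e₄] at e₉
  rw [e₅] at e₁₀
  exact (o.isColoring_iff f).trans <| and_congr (Fin.forall_fin_two.trans <|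
      and_congr (crossingRule_congr e₄ e₂) (crossingRule_congr e₅ e₇))
    (Fin.forall_fin_one.trans (vertexRule_congr e₈ e₉ e₁₀))

theorem sixL_isColoring_iff (o : sixL.YOrientation) (f : Fin 5 → X) : o.IsColoring f ↔
    VertexRule (signed (!o.inB 0) (f 0)) (signed (!o.inB 1) (f 1))
      (signed (o.inV (0 : Fin 2) 2) (f 4)) ∧
    VertexRule (signed (!o.inV (0 : Fin 2) 2) (f 4)) (signed (!o.inB 2) (f 2))
      (signed (!o.inB 3) (f 3)) := by
  have e₀ : o.inV (0 : Fin 2) 0 = !o.inB 0 := o.inward_arc (by nofun) rfl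
  have e₁ : o.inV (0 : Fin 2) 1 = !o.inB 1 := o.inward_arc (by nofun) rfl
  have e₂ : o.inV (1 : Fin 2) 1 = !o.inB 2 := o.inward_arc (by nofun) rfl
  have e₃ : o.inV (1 : Fin 2) 2 = !o.inB 3 := o.inward_arc (by nofun) rfl
  have e₄ : o.inV (1 : Fin 2) 0 = !o.inV (0 : Fin 2) 2 := o.inward_arc (by nofun) rfl
  exact (o.isColoring_iff f).trans <| (and_iff_right (by nofun)).trans <|
    Fin.forall_fin_two.trans <| and_congr (vertexRule_congr e₀ e₁ rfl) (vertexRule_congr e₄ e₂ e₃)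

theorem sixR_isColoring_iff (o : sixR.YOrientation) (f : Fin 5 → X) : o.IsColoring f ↔
    VertexRule (signed (!o.inB 3) (f 3)) (signed (!o.inB 0) (f 0))
      (signed (o.inV (0 : Fin 2) 2) (f 4)) ∧
    VertexRule (signed (!o.inV (0 : Fin 2) 2) (f 4)) (signed (!o.inB 1) (f 1))
      (signed (!o.inB 2) (f 2)) := by
  have e₀ : o.inV (0 : Fin 2) 0 = !o.inB 3 := o.inward_arc (by nofun) rfl
  have e₁ : o.inV (0 : Fin 2) 1 = !o.inB 0 := o.inward_arc (by nofun) rfl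
  have e₂ : o.inV (1 : Fin 2) 1 = !o.inB 1 := o.inward_arc (by nofun) rfl
  have e₃ : o.inV (1 : Fin 2) 2 = !o.inB 2 := o.inward_arc (by nofun) rfl
  have e₄ : o.inV (1 : Fin 2) 0 = !o.inV (0 : Fin 2) 2 := o.inward_arc (by nofun) rfl
  exact (o.isColoring_iff f).trans <| (and_iff_right (by nofun)).trans <|
    Fin.forall_fin_two.trans <| and_congr (vertexRule_congr e₀ e₁ rfl) (vertexRule_congr e₄ e₂ e₃)

end Picture

section

variable {X : Type u}

namespace CrossingRule

theorem turn_over_iff [Biquandle X] {s t : Bool} {a b c d : X} :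
    CrossingRule s (!t) c b a d ↔ CrossingRule s t a b c d := by
  cases s <;> cases t <;> exact Iff.rfl

theorem kink_eq [Biquandle X] {s : Bool} {a b c : X} (h : CrossingRule s (!s) a a b c) :
    b = c := by
  cases s
  · exact h.1.trans ((Biquandle.under_self a).trans h.2.symm)
  · exact eq_of_under_eq_over (h.1.symm.trans h.2)

theorem exists_kink [Biquandle X] (s : Bool) (b : X) : ∃ a, CrossingRule s (!s) a a b b := by
  cases s
  · obtain ⟨a, rfl⟩ := diagonal_surjective b
    exact ⟨a, rfl, Biquandle.under_self a⟩
  · exact ⟨_, rfl, Biquandle.under_self b⟩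

theorem kink_unique [Biquandle X] {s : Bool} {a a' b c : X} (h : CrossingRule s (!s) a a b c)
    (h' : CrossingRule s (!s) a' a' b c) : a = a' :=
  (h.unique₂₃ h').1

theorem exists_slide_right [Biquandle X] (s₁ s₂ s₃ : Bool) {a₀ a₁ a₂ a₃ a₄ a₅ a₆ a₇ a₈ : X}
    (h₁ : CrossingRule s₁ s₃ a₆ a₂ a₃ a₈) (h₂ : CrossingRule s₁ s₂ a₀ a₁ a₆ a₇)
    (h₃ : CrossingRule s₂ s₃ a₇ a₈ a₄ a₅) :
    ∃ b₆ b₇ b₈, CrossingRule s₁ s₃ a₀ b₈ b₆ a₅ ∧ CrossingRule s₁ s₂ b₆ b₇ a₃ a₄ ∧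
      CrossingRule s₂ s₃ a₁ a₂ b₇ b₈ := by
  cases s₁ <;> cases s₂ <;> cases s₃ <;>
  · obtain ⟨_, _, _, k₂, k₁, k₃⟩ := by
      first
      | exact CrossRel.cube_000 h₂ h₁ h₃
      | exact CrossRel.cube_001 h₂ h₁ h₃
      | exact CrossRel.cube_010 h₂ h₁ h₃
      | exact CrossRel.cube_011 h₂ h₁ h₃
      | exact CrossRel.cube_100 h₂ h₁ h₃
      | exact CrossRel.cube_101 h₂ h₁ h₃
      | exact CrossRel.cube_110 h₂ h₁ h₃
      | exact CrossRel.cube_111 h₂ h₁ h₃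
    exact ⟨_, _, _, k₁, k₂, k₃⟩

theorem exists_slide_left [Biquandle X] (s₁ s₂ s₃ : Bool) {a₀ a₁ a₂ a₃ a₄ a₅ a₆ a₇ a₈ : X}
    (h₁ : CrossingRule s₁ s₃ a₀ a₈ a₆ a₅) (h₂ : CrossingRule s₁ s₂ a₆ a₇ a₃ a₄)
    (h₃ : CrossingRule s₂ s₃ a₁ a₂ a₇ a₈) :
    ∃ b₆ b₇ b₈, CrossingRule s₁ s₃ b₆ a₂ a₃ b₈ ∧ CrossingRule s₁ s₂ a₀ a₁ b₆ b₇ ∧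
      CrossingRule s₂ s₃ b₇ b₈ a₄ a₅ := by
  cases s₁ <;> cases s₂ <;> cases s₃ <;>
  · obtain ⟨_, _, _, k₂, k₁, k₃⟩ := by
      first
      | exact CrossRel.cube_000 h₂ h₁ h₃
      | exact CrossRel.cube_001 h₂ h₁ h₃
      | exact CrossRel.cube_010 h₂ h₁ h₃
      | exact CrossRel.cube_011 h₂ h₁ h₃
      | exact CrossRel.cube_100 h₂ h₁ h₃
      | exact CrossRel.cube_101 h₂ h₁ h₃
      | exact CrossRel.cube_110 h₂ h₁ h₃
      | exact CrossRel.cube_111 h₂ h₁ h₃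
    exact ⟨_, _, _, k₁, k₂, k₃⟩

variable [PartiallyMultiplicativeBiquandle X] {s t p : Bool} {a b c d x y z w : X}

theorem signed_under_iff (h : IsFactor a ∨ IsFactor c) :
    CrossingRule true t (signed s a) b (signed s c) d ↔ CrossingRule s t a b c d := by
  by_cases ha : IsFactor a
  · simpa using signed_under (s := s) (t := t) (b := b) (c := c) (d := d) s ha
  · have hc := h.resolve_left ha
    refine iff_of_false (fun k => ha ?_) (fun k => ha (k.isFactor_under.1 hc))
    exact isFactor_signed.1 (k.isFactor_under.1 (hc.signed s))

theorem signed_over_iff (h : IsFactor b ∨ IsFactor d) :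
    CrossingRule s true a (signed t b) c (signed t d) ↔ CrossingRule s t a b c d := by
  by_cases hb : IsFactor b
  · simpa using signed_over (s := s) (t := t) (a := a) (c := c) (d := d) t hb
  · have hd := h.resolve_left hb
    refine iff_of_false (fun k => hb ?_) (fun k => hb (k.isFactor_over.1 hd))
    exact isFactor_signed.1 (k.isFactor_over.1 (hd.signed t))

/-- A strand passing over a vertex at which an edge with the color `d = ab` is split into two
edges with the colors `a` and `b`, moved from the edge colored by the product to the other two. -/
theorem exists_split (h : CrossingRule true t x y d w) (hp : IsProd a b d) :
    ∃ a' b' z, CrossingRule true t b' y b z ∧ CrossingRule true t a' z a w ∧ IsProd a' b' x := by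
  cases t
  · obtain ⟨rfl, rfl⟩ := h
    exact ⟨_, _, _, ⟨rfl, hp.over_act w⟩, ⟨rfl, rfl⟩, (IsProd.under_iff w).2 hp⟩
  · obtain ⟨rfl, rfl⟩ := h
    obtain ⟨a', rfl⟩ := (Biquandle.under_bijective w).2 a
    obtain ⟨b', rfl⟩ := (Biquandle.under_bijective (Biquandle.passOver w a')).2 b
    have hp' := (IsProd.under_iff w).1 hp
    exact ⟨a', b', _, ⟨rfl, hp'.over_act w⟩, ⟨rfl, rfl⟩, hp'⟩

/-- The move inverse to that of `CrossingRule.exists_split`. -/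
theorem exists_unsplit {a' b' : X} (h₁ : CrossingRule true t b' y b z)
    (h₂ : CrossingRule true t a' z a w) (hp : IsProd a' b' x) :
    ∃ d, CrossingRule true t x y d w ∧ IsProd a b d := by
  cases t
  · obtain ⟨rfl, rfl⟩ := h₁
    obtain ⟨rfl, rfl⟩ := h₂
    obtain ⟨d, rfl⟩ := (Biquandle.under_bijective w).2 x
    have hp' := (IsProd.under_iff w).1 hp
    exact ⟨d, ⟨rfl, (hp'.over_act w).symm⟩, hp'⟩
  · obtain ⟨rfl, rfl⟩ := h₁
    obtain ⟨rfl, rfl⟩ := h₂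
    exact ⟨_, ⟨rfl, (hp.over_act w).symm⟩, (IsProd.under_iff w).2 hp⟩

theorem split_iff {r s t : Bool} : VertexRule (signed (!r) x) (signed (!s) a) (signed (!t) b) ↔
    IsProd (signed t b) (signed s a) (signed (!r) x) := by
  rw [VertexRule.reverse_iff, signed_not, signed_not, signed_not, pinv_pinv, pinv_pinv]

theorem exists_twist {r : Bool}
    (h : VertexRule (signed (!r) x) (signed (!s) c) (signed (!t) d)) :
    ∃ a b, CrossingRule s t a b c d ∧
      VertexRule (signed (!r) x) (signed (!t) b) (signed (!s) a) := by
  rw [split_iff] at h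
  have hc := isFactor_signed.1 h.isFactor_right
  have hd := isFactor_signed.1 h.isFactor_left
  obtain ⟨a, b, k⟩ := exists₂₃ s t c d
  refine ⟨a, b, k, split_iff.2 ?_⟩
  have k' := (signed_over_iff (.inr hd)).2 ((signed_under_iff (.inr hc)).2 k)
  rw [k'.1] at h
  rw [k'.2]
  exact IsProd.swap_iff.1 h

theorem vertexRule_of_twist {r : Bool} (k : CrossingRule s t a b c d)
    (h : VertexRule (signed (!r) x) (signed (!t) b) (signed (!s) a)) :
    VertexRule (signed (!r) x) (signed (!s) c) (signed (!t) d) := by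
  rw [split_iff] at h ⊢
  have ha := isFactor_signed.1 h.isFactor_left
  have hb := isFactor_signed.1 h.isFactor_right
  have k' := (signed_over_iff (.inl hb)).2 ((signed_under_iff (.inl ha)).2 k)
  rw [k'.1]
  rw [k'.2] at h
  exact IsProd.swap_iff.2 h

theorem exists_pass {r : Bool} (h : CrossingRule (!r) t x y d w)
    (hv : VertexRule (signed (!r) d) (signed (!s) b) (signed (!p) a)) :
    ∃ b' a' z, (CrossingRule s t b' y b z ∧ CrossingRule p t a' z a w) ∧
      VertexRule (signed (!r) x) (signed (!s) b') (signed (!p) a') := by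
  rw [split_iff] at hv
  obtain ⟨a', b', z, h₁, h₂, h₃⟩ := exists_split
    ((signed_under_iff (.inr (isFactor_signed.1 hv.isFactor))).2 h) hv
  refine ⟨signed s b', signed p a', z, ⟨(signed_under_iff (.inr ?_)).1 ?_,
    (signed_under_iff (.inr ?_)).1 ?_⟩, split_iff.2 ?_⟩
  · exact isFactor_signed.1 hv.isFactor_right
  · rwa [signed_signed]
  · exact isFactor_signed.1 hv.isFactor_left
  · rwa [signed_signed]
  · rwa [signed_signed, signed_signed]

theorem exists_unpass {r : Bool} {a' b' : X} (h₁ : CrossingRule s t b' y b z)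
    (h₂ : CrossingRule p t a' z a w)
    (hv : VertexRule (signed (!r) x) (signed (!s) b') (signed (!p) a')) :
    ∃ d, CrossingRule (!r) t x y d w ∧
      VertexRule (signed (!r) d) (signed (!s) b) (signed (!p) a) := by
  rw [split_iff] at hv
  obtain ⟨d, h₃, h₄⟩ := exists_unsplit
    ((signed_under_iff (.inl (isFactor_signed.1 hv.isFactor_right))).2 h₁)
    ((signed_under_iff (.inl (isFactor_signed.1 hv.isFactor_left))).2 h₂) hv
  refine ⟨signed (!r) d, (signed_under_iff (.inl ?_)).1 ?_, split_iff.2 ?_⟩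
  · exact isFactor_signed.1 hv.isFactor
  · rwa [signed_signed]
  · rwa [signed_signed]

end CrossingRule

theorem VertexRule.exists_exchange [PartiallyMultiplicativeBiquandle X] {x y z w e : X} {r : Bool}
    (q : Bool) (h : VertexRule x y (signed r e)) (h' : VertexRule (signed (!r) e) z w) :
    ∃ f, VertexRule w x (signed q f) ∧ VertexRule (signed (!q) f) y z := by
  rw [signed_not] at h'
  obtain ⟨f, h₁, h₂⟩ := h.exchange h'
  refine ⟨signed q f, ?_, ?_⟩
  · rwa [signed_signed]
  · rwa [signed_not, signed_signed]

namespace Picture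

open CrossingRule

variable [PartiallyMultiplicativeBiquandle X]

theorem rigid_oneL : Rigid oneL X :=
  fun _ _ _ _ _ h => funext (Fin.forall_fin_one.2 (h (0 : Fin 2)))

theorem rigid_oneR : Rigid oneR X := by
  intro o f g hf hg h
  replace hf := (oneR_isColoring_iff o f).1 hf
  replace hg := (oneR_isColoring_iff o g).1 hg
  have h₁ : f (1 : Fin 3) = g (1 : Fin 3) := h (0 : Fin 2)
  have h₂ : f (2 : Fin 3) = g (2 : Fin 3) := h (1 : Fin 2)
  rw [h₁, h₂] at hf
  exact funext (forall_fin_three.2 ⟨kink_unique hf hg, h₁, h₂⟩)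

theorem transfers_one : Transfers oneL oneR X := by
  intro o o' _ f hf
  obtain ⟨a, ha⟩ := exists_kink (o'.inB 0) (f (0 : Fin 1))
  exact ⟨(![a, f (0 : Fin 1), f (0 : Fin 1)] : Fin 3 → X), (oneR_isColoring_iff o' _).2 ha,
    Fin.forall_fin_two.2 ⟨rfl, rfl⟩⟩

theorem transfers_one_symm : Transfers oneR oneL X := by
  intro o o' _ f hf
  have h := kink_eq ((oneR_isColoring_iff o f).1 hf)
  exact ⟨fun _ => f (1 : Fin 3), oneL_isColoring o' _, Fin.forall_fin_two.2 ⟨rfl, h⟩⟩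

theorem rigid_twoL : Rigid twoL X :=
  fun _ _ _ _ _ h => funext (Fin.forall_fin_two.2 ⟨h (0 : Fin 4), h (1 : Fin 4)⟩)

theorem rigid_twoR : Rigid twoR X := by
  intro o f g hf hg h
  obtain ⟨hf, -⟩ := (twoR_isColoring_iff o f).1 hf
  obtain ⟨hg, -⟩ := (twoR_isColoring_iff o g).1 hg
  have h₀ : f (0 : Fin 6) = g (0 : Fin 6) := h (0 : Fin 4)
  have h₁ : f (1 : Fin 6) = g (1 : Fin 6) := h (1 : Fin 4)
  have h₄ : f (4 : Fin 6) = g (4 : Fin 6) := h (2 : Fin 4)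
  have h₅ : f (5 : Fin 6) = g (5 : Fin 6) := h (3 : Fin 4)
  rw [h₀, h₁] at hf
  obtain ⟨h₂, h₃⟩ := hf.unique₀₁ hg
  funext i
  change Fin 6 at i
  fin_cases i
  exacts [h₀, h₁, h₂, h₃, h₄, h₅]

theorem transfers_two : Transfers twoL twoR X := by
  intro o o' _ f hf
  obtain ⟨c, d, h⟩ := exists₀₁ (!o'.inB 0) (!o'.inB 1) (f (0 : Fin 2)) (f (1 : Fin 2))
  refine ⟨(![f (0 : Fin 2), f (1 : Fin 2), c, d, f (1 : Fin 2), f (0 : Fin 2)] : Fin 6 → X),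
    (twoR_isColoring_iff o' _).2 ⟨h, ?_⟩, ?_⟩
  · rw [← Bool.not_not (o'.inB 1)]
    exact turn_over_iff.2 h
  · intro i
    change Fin 4 at i
    fin_cases i <;> rfl

theorem transfers_two_symm : Transfers twoR twoL X := by
  intro o o' _ f hf
  obtain ⟨h, h'⟩ := (twoR_isColoring_iff o f).1 hf
  rw [← Bool.not_not (o.inB 1)] at h'
  obtain ⟨h₁, h₂⟩ := h.unique₂₃ (turn_over_iff.1 h')
  refine ⟨(![f (0 : Fin 6), f (1 : Fin 6)] : Fin 2 → X), twoL_isColoring o' _, ?_⟩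
  intro i
  change Fin 4 at i
  fin_cases i
  exacts [rfl, rfl, h₂, h₁]

theorem rigid_threeL : Rigid threeL X := by
  intro o f g hf hg h
  obtain ⟨hf, -, hf'⟩ := (threeL_isColoring_iff o f).1 hf
  obtain ⟨hg, -, hg'⟩ := (threeL_isColoring_iff o g).1 hg
  have h₀ : f (0 : Fin 9) = g (0 : Fin 9) := h (0 : Fin 6)
  have h₁ : f (1 : Fin 9) = g (1 : Fin 9) := h (1 : Fin 6)
  have h₂ : f (2 : Fin 9) = g (2 : Fin 9) := h (2 : Fin 6)
  have h₃ : f (3 : Fin 9) = g (3 : Fin 9) := h (3 : Fin 6)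
  have h₄ : f (4 : Fin 9) = g (4 : Fin 9) := h (4 : Fin 6)
  have h₅ : f (5 : Fin 9) = g (5 : Fin 9) := h (5 : Fin 6)
  rw [h₄, h₅] at hf'
  obtain ⟨h₇, h₈⟩ := hf'.unique₂₃ hg'
  rw [h₂, h₃] at hf
  obtain ⟨h₆, -⟩ := hf.unique₁₂ hg
  funext i
  change Fin 9 at i
  fin_cases i
  exacts [h₀, h₁, h₂, h₃, h₄, h₅, h₆, h₇, h₈]

theorem rigid_threeR : Rigid threeR X := by
  intro o f g hf hg h
  obtain ⟨-, hf, hf'⟩ := (threeR_isColoring_iff o f).1 hf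
  obtain ⟨-, hg, hg'⟩ := (threeR_isColoring_iff o g).1 hg
  have h₀ : f (0 : Fin 9) = g (0 : Fin 9) := h (0 : Fin 6)
  have h₁ : f (1 : Fin 9) = g (1 : Fin 9) := h (1 : Fin 6)
  have h₂ : f (2 : Fin 9) = g (2 : Fin 9) := h (2 : Fin 6)
  have h₃ : f (3 : Fin 9) = g (3 : Fin 9) := h (3 : Fin 6)
  have h₄ : f (4 : Fin 9) = g (4 : Fin 9) := h (4 : Fin 6)
  have h₅ : f (5 : Fin 9) = g (5 : Fin 9) := h (5 : Fin 6)
  rw [h₁, h₂] at hf'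
  obtain ⟨h₇, h₈⟩ := hf'.unique₀₁ hg'
  rw [h₃, h₄] at hf
  obtain ⟨h₆, -⟩ := hf.unique₂₃ hg
  funext i
  change Fin 9 at i
  fin_cases i
  exacts [h₀, h₁, h₂, h₃, h₄, h₅, h₆, h₇, h₈]

theorem transfers_three : Transfers threeL threeR X := by
  intro o o' hb f hf
  obtain ⟨h₁, h₂, h₃⟩ := (threeL_isColoring_iff o f).1 hf
  obtain ⟨b₆, b₇, b₈, k⟩ := exists_slide_right _ _ _ h₁ h₂ h₃
  rw [hb, hb, hb] at k
  refine ⟨(![f (0 : Fin 9), f (1 : Fin 9), f (2 : Fin 9), f (3 : Fin 9), f (4 : Fin 9),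
    f (5 : Fin 9), b₆, b₇, b₈] : Fin 9 → X), (threeR_isColoring_iff o' _).2 k, fun i => ?_⟩
  change Fin 6 at i
  fin_cases i <;> rfl

theorem transfers_three_symm : Transfers threeR threeL X := by
  intro o o' hb f hf
  obtain ⟨h₁, h₂, h₃⟩ := (threeR_isColoring_iff o f).1 hf
  obtain ⟨b₆, b₇, b₈, k⟩ := exists_slide_left _ _ _ h₁ h₂ h₃
  rw [hb, hb, hb] at k
  refine ⟨(![f (0 : Fin 9), f (1 : Fin 9), f (2 : Fin 9), f (3 : Fin 9), f (4 : Fin 9),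
    f (5 : Fin 9), b₆, b₇, b₈] : Fin 9 → X), (threeL_isColoring_iff o' _).2 k, fun i => ?_⟩
  change Fin 6 at i
  fin_cases i <;> rfl

theorem rigid_fourL : Rigid fourL X :=
  fun _ _ _ _ _ h => funext (forall_fin_three.2 ⟨h (0 : Fin 3), h (1 : Fin 3), h (2 : Fin 3)⟩)

theorem rigid_fourR : Rigid fourR X := by
  intro o f g hf hg h
  obtain ⟨hf, -⟩ := (fourR_isColoring_iff o f).1 hf
  obtain ⟨hg, -⟩ := (fourR_isColoring_iff o g).1 hg
  have h₀ : f (0 : Fin 5) = g (0 : Fin 5) := h (0 : Fin 3)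
  have h₁ : f (1 : Fin 5) = g (1 : Fin 5) := h (1 : Fin 3)
  have h₂ : f (2 : Fin 5) = g (2 : Fin 5) := h (2 : Fin 3)
  rw [h₁, h₂] at hf
  obtain ⟨h₄, h₃⟩ := hf.unique₂₃ hg
  funext i
  change Fin 5 at i
  fin_cases i
  exacts [h₀, h₁, h₂, h₃, h₄]

theorem transfers_four : Transfers fourL fourR X := by
  intro o o' hb f hf
  obtain ⟨a, b, h⟩ := exists_twist ((fourL_isColoring_iff o f).1 hf)
  rw [hb, hb, hb] at h
  exact ⟨(![f (0 : Fin 3), f (1 : Fin 3), f (2 : Fin 3), b, a] : Fin 5 → X),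
    (fourR_isColoring_iff o' _).2 h, forall_fin_three.2 ⟨rfl, rfl, rfl⟩⟩

theorem transfers_four_symm : Transfers fourR fourL X := by
  intro o o' hb f hf
  obtain ⟨h, h'⟩ := (fourR_isColoring_iff o f).1 hf
  have k := vertexRule_of_twist h h'
  rw [hb, hb, hb] at k
  exact ⟨(![f (0 : Fin 5), f (1 : Fin 5), f (2 : Fin 5)] : Fin 3 → X),
    (fourL_isColoring_iff o' _).2 k, forall_fin_three.2 ⟨rfl, rfl, rfl⟩⟩

theorem rigid_fiveL : Rigid fiveL X := by
  intro o f g hf hg h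
  obtain ⟨hf, -⟩ := (fiveL_isColoring_iff o f).1 hf
  obtain ⟨hg, -⟩ := (fiveL_isColoring_iff o g).1 hg
  have h₀ : f (0 : Fin 6) = g (0 : Fin 6) := h (0 : Fin 5)
  have h₁ : f (1 : Fin 6) = g (1 : Fin 6) := h (1 : Fin 5)
  have h₂ : f (2 : Fin 6) = g (2 : Fin 6) := h (2 : Fin 5)
  have h₃ : f (3 : Fin 6) = g (3 : Fin 6) := h (3 : Fin 5)
  have h₄ : f (4 : Fin 6) = g (4 : Fin 6) := h (4 : Fin 5)
  rw [h₀, h₁] at hf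
  obtain ⟨h₅, -⟩ := hf.unique₀₁ hg
  funext i
  change Fin 6 at i
  fin_cases i
  exacts [h₀, h₁, h₂, h₃, h₄, h₅]

theorem rigid_fiveR : Rigid fiveR X := by
  intro o f g hf hg h
  obtain ⟨⟨hf, hf'⟩, -⟩ := (fiveR_isColoring_iff o f).1 hf
  obtain ⟨⟨hg, hg'⟩, -⟩ := (fiveR_isColoring_iff o g).1 hg
  have h₀ : f (0 : Fin 8) = g (0 : Fin 8) := h (0 : Fin 5)
  have h₁ : f (1 : Fin 8) = g (1 : Fin 8) := h (1 : Fin 5)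
  have h₂ : f (2 : Fin 8) = g (2 : Fin 8) := h (2 : Fin 5)
  have h₃ : f (3 : Fin 8) = g (3 : Fin 8) := h (3 : Fin 5)
  have h₄ : f (4 : Fin 8) = g (4 : Fin 8) := h (4 : Fin 5)
  rw [h₃, h₄] at hf'
  obtain ⟨h₆, h₇⟩ := hf'.unique₂₃ hg'
  rw [h₁, h₂] at hf
  obtain ⟨h₅, -⟩ := hf.unique₁₂ hg
  funext i
  change Fin 8 at i
  fin_cases i
  exacts [h₀, h₁, h₂, h₃, h₄, h₅, h₆, h₇]

theorem transfers_five : Transfers fiveL fiveR X := by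
  intro o o' hb f hf
  obtain ⟨h, h'⟩ := (fiveL_isColoring_iff o f).1 hf
  obtain ⟨a₅, a₆, a₇, k⟩ := exists_pass h h'
  rw [hb, hb, hb, hb] at k
  refine ⟨(![f (0 : Fin 6), f (1 : Fin 6), f (2 : Fin 6), f (3 : Fin 6), f (4 : Fin 6), a₅, a₆, a₇] :
    Fin 8 → X), (fiveR_isColoring_iff o' _).2 k, fun i => ?_⟩
  change Fin 5 at i
  fin_cases i <;> rfl

theorem transfers_five_symm : Transfers fiveR fiveL X := by
  intro o o' hb f hf
  obtain ⟨⟨h, h'⟩, h''⟩ := (fiveR_isColoring_iff o f).1 hf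
  obtain ⟨a₅, k⟩ := exists_unpass h h' h''
  rw [hb, hb, hb, hb] at k
  refine ⟨(![f (0 : Fin 8), f (1 : Fin 8), f (2 : Fin 8), f (3 : Fin 8), f (4 : Fin 8), a₅] :
    Fin 6 → X), (fiveL_isColoring_iff o' _).2 k, fun i => ?_⟩
  change Fin 5 at i
  fin_cases i <;> rfl

theorem rigid_sixL : Rigid sixL X := by
  intro o f g hf hg h
  obtain ⟨hf, -⟩ := (sixL_isColoring_iff o f).1 hf
  obtain ⟨hg, -⟩ := (sixL_isColoring_iff o g).1 hg
  have h₀ : f (0 : Fin 5) = g (0 : Fin 5) := h (0 : Fin 4)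
  have h₁ : f (1 : Fin 5) = g (1 : Fin 5) := h (1 : Fin 4)
  have h₂ : f (2 : Fin 5) = g (2 : Fin 5) := h (2 : Fin 4)
  have h₃ : f (3 : Fin 5) = g (3 : Fin 5) := h (3 : Fin 4)
  rw [h₀, h₁] at hf
  have h₄ := signed_injective _ (hf.unique hg)
  funext i
  change Fin 5 at i
  fin_cases i
  exacts [h₀, h₁, h₂, h₃, h₄]

theorem rigid_sixR : Rigid sixR X := by
  intro o f g hf hg h
  obtain ⟨hf, -⟩ := (sixR_isColoring_iff o f).1 hf
  obtain ⟨hg, -⟩ := (sixR_isColoring_iff o g).1 hg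
  have h₀ : f (0 : Fin 5) = g (0 : Fin 5) := h (0 : Fin 4)
  have h₁ : f (1 : Fin 5) = g (1 : Fin 5) := h (1 : Fin 4)
  have h₂ : f (2 : Fin 5) = g (2 : Fin 5) := h (2 : Fin 4)
  have h₃ : f (3 : Fin 5) = g (3 : Fin 5) := h (3 : Fin 4)
  rw [h₀, h₃] at hf
  have h₄ := signed_injective _ (hf.unique hg)
  funext i
  change Fin 5 at i
  fin_cases i
  exacts [h₀, h₁, h₂, h₃, h₄]

theorem transfers_six : Transfers sixL sixR X := by
  intro o o' hb f hf
  obtain ⟨h, h'⟩ := (sixL_isColoring_iff o f).1 hf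
  obtain ⟨a, k⟩ := VertexRule.exists_exchange (o'.inV (0 : Fin 2) 2) h h'
  rw [hb, hb, hb, hb] at k
  refine ⟨(![f (0 : Fin 5), f (1 : Fin 5), f (2 : Fin 5), f (3 : Fin 5), a] : Fin 5 → X),
    (sixR_isColoring_iff o' _).2 k, fun i => ?_⟩
  change Fin 4 at i
  fin_cases i <;> rfl

theorem transfers_six_symm : Transfers sixR sixL X := by
  intro o o' hb f hf
  obtain ⟨h, h'⟩ := (sixR_isColoring_iff o f).1 hf
  obtain ⟨a, k, k'⟩ := VertexRule.exists_exchange (!o'.inV (0 : Fin 2) 2) h h'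
  rw [hb, hb] at k k'
  rw [Bool.not_not] at k'
  refine ⟨(![f (0 : Fin 5), f (1 : Fin 5), f (2 : Fin 5), f (3 : Fin 5), a] : Fin 5 → X),
    (sixL_isColoring_iff o' _).2 ⟨k'.rotate, k.rotate.rotate⟩, fun i => ?_⟩
  change Fin 4 at i
  fin_cases i <;> rfl

theorem BasicMove.transfers {n : ℕ} {P Q : Picture n} (h : BasicMove P Q) : Transfers P Q X := by
  cases h
  exacts [transfers_one, transfers_two, transfers_three, transfers_four, transfers_five,
    transfers_six]

theorem BasicMove.transfers_symm {n : ℕ} {P Q : Picture n} (h : BasicMove P Q) :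
    Transfers Q P X := by
  cases h
  exacts [transfers_one_symm, transfers_two_symm, transfers_three_symm, transfers_four_symm,
    transfers_five_symm, transfers_six_symm]

theorem BasicMove.rigid_left {n : ℕ} {P Q : Picture n} (h : BasicMove P Q) : Rigid P X := by
  cases h
  exacts [rigid_oneL, rigid_twoL, rigid_threeL, rigid_fourL, rigid_fiveL, rigid_sixL]

theorem BasicMove.rigid_right {n : ℕ} {P Q : Picture n} (h : BasicMove P Q) : Rigid Q X := by
  cases h
  exacts [rigid_oneR, rigid_twoR, rigid_threeR, rigid_fourR, rigid_fiveR, rigid_sixR]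

end Picture

end

/-- The partially multiplicative biquandle with the two biquandle operations exchanged. -/
def OverUnderSwap (X : Type u) : Type u := X

namespace OverUnderSwap

open Biquandle PartiallyMultiplicativeBiquandle

instance (X : Type u) [Biquandle X] : Biquandle (OverUnderSwap X) where
  passUnder := passOver (X := X)
  passOver := passUnder (X := X)
  under_self x := (under_self (X := X) x).symm
  over_bijective := under_bijective (X := X)
  under_bijective := over_bijective (X := X)
  switch_bijective := (Equiv.prodComm X X).bijective.comp
    ((switch_bijective (X := X)).comp (Equiv.prodComm X X).bijective)
  exchange_uu := exchange_oo (X := X)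
  exchange_uo x y z := (exchange_uo (X := X) x z y).symm
  exchange_oo := exchange_uu (X := X)

instance (X : Type u) [PartiallyMultiplicativeBiquandle X] :
    PartiallyMultiplicativeBiquandle (OverUnderSwap X) where
  D := D (X := X)
  mul := mul (X := X)
  mul_left_injective := mul_left_injective (X := X)
  mul_right_injective := mul_right_injective (X := X)
  D_swap a b := (D_swap (X := X) b a).symm
  mul_swap a b h h' := (mul_swap (X := X) b a h' h).symm
  D_under := D_over (X := X)
  D_over := D_under (X := X)
  under_mul := over_mul (X := X)
  over_mul := under_mul (X := X)
  mul_under := mul_over (X := X)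
  mul_over := mul_under (X := X)
  D_assoc := D_assoc (X := X)
  mul_assoc := PartiallyMultiplicativeBiquandle.mul_assoc (X := X)
  mul_eq_mul_iff := mul_eq_mul_iff (X := X)

end OverUnderSwap

namespace Picture

variable {n : ℕ} {P Q : Picture n} {X : Type u} [PartiallyMultiplicativeBiquandle X]

/-- The orientation of a picture which corresponds to an orientation of its mirror image. -/
def YOrientation.unmirror (o : P.mirror.YOrientation) : P.YOrientation where
  inward p := o.inward (Sum.map (Prod.map id (· - 1)) id p)
  arc_dir p q hpq h := by
    have key (p : Port P.C P.V n) : P.mirror.arc (Sum.map (Prod.map id (· - 1)) id p) = P.arc p := by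
      rcases p with ⟨c, i⟩ | p
      · exact congrArg (fun i => P.arc (Sum.inl (c, i))) (sub_add_cancel i 1)
      · rfl
    have inj : Function.Injective
        (Sum.map (Prod.map id (· - 1)) id : Port P.C P.V n → Port P.C P.V n) :=
      (Function.injective_id.prodMap (sub_left_injective (b := (1 : Fin 4)))).sumMap
        Function.injective_id
    exact o.arc_dir _ _ (inj.ne hpq) ((key p).trans (h.trans (key q).symm))
  crossing_dir c i := by
    have := o.crossing_dir c (i - 1)
    rwa [sub_add_eq_add_sub] at this
  vertex_dir v := o.vertex_dir v

theorem crossingRule_swap {s t : Bool} {a b c d : X} :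
    CrossingRule (X := OverUnderSwap X) (!t) s a b c d ↔ CrossingRule s t b c d a := by
  cases s <;> cases t <;> exact and_comm

theorem YOrientation.crossingRule_unmirror_iff (o : P.mirror.YOrientation) (f : P.E → X)
    (c : P.C) : CrossingRule (X := OverUnderSwap X) (o.unmirror.inC c 0) (o.unmirror.inC c 1)
      (f (P.arcC c 0)) (f (P.arcC c 1)) (f (P.arcC c 2)) (f (P.arcC c 3)) ↔
    CrossingRule (o.inC c 0) (o.inC c 1) (f (P.mirror.arcC c 0)) (f (P.mirror.arcC c 1))
      (f (P.mirror.arcC c 2)) (f (P.mirror.arcC c 3)) := by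
  have h : o.unmirror.inC c 0 = !o.inC c 1 := o.inC_add_two c 1
  rw [h]
  exact crossingRule_swap

theorem YOrientation.isColoring_unmirror_iff (o : P.mirror.YOrientation) (f : P.E → X) :
    o.unmirror.IsColoring (X := OverUnderSwap X) f ↔ o.IsColoring f := by
  refine ⟨fun h => ?_, fun h => ?_⟩
  · have hc := fun c => (o.crossing_rules_iff f c).2 <| (o.crossingRule_unmirror_iff f c).1 <|
      (o.unmirror.crossing_rules_iff (X := OverUnderSwap X) f c).1 ⟨h.under_rule c, h.over_rule c⟩
    exact ⟨fun c => (hc c).1, fun c => (hc c).2, h.merge, h.split⟩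
  · have hc := fun c => (o.unmirror.crossing_rules_iff (X := OverUnderSwap X) f c).2 <|
      (o.crossingRule_unmirror_iff f c).2 <|
      (o.crossing_rules_iff f c).1 ⟨h.under_rule c, h.over_rule c⟩
    exact ⟨fun c => (hc c).1, fun c => (hc c).2, h.merge, h.split⟩

theorem Rigid.mirror (h : Rigid P (OverUnderSwap X)) : Rigid P.mirror X :=
  fun o f g hf hg hb => h o.unmirror f g ((o.isColoring_unmirror_iff f).2 hf)
    ((o.isColoring_unmirror_iff g).2 hg) hb

theorem Transfers.mirror (h : Transfers P Q (OverUnderSwap X)) :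
    Transfers P.mirror Q.mirror X := by
  intro o o' hb f hf
  obtain ⟨g, hg, h⟩ := h o.unmirror o'.unmirror hb f ((o.isColoring_unmirror_iff f).2 hf)
  exact ⟨g, (o'.isColoring_unmirror_iff (X := X) g).1 hg, h⟩

theorem LocalMove.symm {P Q : Picture n} (h : LocalMove P Q) : LocalMove Q P := by
  cases h with
  | basic h => exact .basic_symm h
  | basic_symm h => exact .basic h
  | mirror h => exact .mirror_symm h
  | mirror_symm h => exact .mirror h

theorem LocalMove.transfers {P Q : Picture n} (h : LocalMove P Q) : Transfers P Q X := by
  cases h with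
  | basic h => exact h.transfers
  | basic_symm h => exact h.transfers_symm
  | mirror h => exact h.transfers.mirror
  | mirror_symm h => exact h.transfers_symm.mirror

theorem LocalMove.rigid {P Q : Picture n} (h : LocalMove P Q) : Rigid Q X := by
  cases h with
  | basic h => exact h.rigid_right
  | basic_symm h => exact h.rigid_left
  | mirror h => exact h.rigid_right.mirror
  | mirror_symm h => exact h.rigid_left.mirror

end Picture

namespace Gluing

variable {Γ : YDiagram} {n : ℕ} {T P : Picture n} {o : T.YOrientation} {o' : P.YOrientation}
  {X : Type u} [PartiallyMultiplicativeBiquandle X]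

theorem arc_boundary (G : Gluing Γ o o') (i : Fin n) :
    G.arc (Sum.inl (T.arcB i)) = G.arc (Sum.inr (P.arcB i)) :=
  (G.arc_eq_iff _ _).2 (.rel _ _ ⟨i, rfl, rfl⟩)

theorem isColoring_iff (G : Gluing Γ o o') (f : Γ.E → X) :
    Γ.orient.IsColoring f ↔ o.IsColoring (fun e => f (G.arc (Sum.inl e))) ∧
      o'.IsColoring (fun e => f (G.arc (Sum.inr e))) := by
  simp only [Picture.YOrientation.isColoring_iff, ← G.crossing.forall_congr_right,
    ← G.vertex.forall_congr_right, Sum.forall, G.arc_crossing_outer, G.arc_crossing_inner,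
    G.arc_vertex_outer, G.arc_vertex_inner, G.dir_crossing_outer, G.dir_crossing_inner,
    G.dir_vertex_outer, G.dir_vertex_inner]
  tauto

theorem exists_glue (G : Gluing Γ o o') {Y : Type u} (f : T.E → Y) (g : P.E → Y)
    (h : ∀ i, g (P.arcB i) = f (T.arcB i)) :
    ∃ k : Γ.E → Y, (∀ e, k (G.arc (Sum.inl e)) = f e) ∧ ∀ e, k (G.arc (Sum.inr e)) = g e := by
  have key : ∀ x y, G.arc x = G.arc y → Sum.elim f g x = Sum.elim f g y := by
    intro x y hxy
    induction (G.arc_eq_iff x y).1 hxy with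
    | rel x y h' =>
      obtain ⟨i, rfl, rfl⟩ := h'
      exact (h i).symm
    | refl => rfl
    | symm x y h' ih => exact (ih ((G.arc_eq_iff _ _).2 h')).symm
    | trans x y z h₁ h₂ ih₁ ih₂ =>
      exact (ih₁ ((G.arc_eq_iff _ _).2 h₁)).trans (ih₂ ((G.arc_eq_iff _ _).2 h₂))
  have h' (x) : Sum.elim f g (Function.surjInv G.arc_surjective (G.arc x)) = Sum.elim f g x :=
    key _ _ (Function.surjInv_eq G.arc_surjective _)
  exact ⟨fun e => Sum.elim f g (Function.surjInv G.arc_surjective e), fun e => h' (Sum.inl e),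
    fun e => h' (Sum.inr e)⟩

end Gluing

namespace HandlebodyMove

variable {Γ Γ' : YDiagram} {X : Type u} [PartiallyMultiplicativeBiquandle X]

/-- The inverse of a handlebody-knot Reidemeister move. -/
def symm (m : HandlebodyMove Γ Γ') : HandlebodyMove Γ' Γ where
  n := m.n
  outer := m.outer
  inner := m.inner'
  inner' := m.inner
  isMove := m.isMove.symm
  outerOrient := m.outerOrient
  innerOrient := m.innerOrient'
  innerOrient' := m.innerOrient
  source := m.target
  target := m.source

theorem agree_symm_iff (m : HandlebodyMove Γ Γ') {f : Γ.Coloring X} {f' : Γ'.Coloring X} :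
    m.symm.Agree f' f ↔ m.Agree f f' :=
  forall_congr' fun _ => eq_comm

theorem existsUnique_agree (m : HandlebodyMove Γ Γ') (f : Γ.Coloring X) :
    ∃! f' : Γ'.Coloring X, m.Agree f f' := by
  obtain ⟨hT, hP⟩ := (m.source.isColoring_iff f.1).1 f.2
  obtain ⟨g, hg, hb⟩ := m.isMove.transfers m.innerOrient m.innerOrient'
    (fun i => Bool.not_inj ((Bool.eq_not.2 (m.source.dir_boundary i)).symm.trans
      (Bool.eq_not.2 (m.target.dir_boundary i)))) _ hP
  obtain ⟨k, hk, hk'⟩ := m.target.exists_glue (fun e => f.1 (m.source.arc (Sum.inl e))) g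
    (fun i => (hb i).trans (congrArg f.1 (m.source.arc_boundary i)).symm)
  refine ⟨⟨k, (m.target.isColoring_iff k).2 ⟨?_, ?_⟩⟩, hk, fun f' hf' => Subtype.ext ?_⟩
  · simpa only [hk] using hT
  · simpa only [hk'] using hg
  · have hr := m.isMove.rigid m.innerOrient' (fun e => f'.1 (m.target.arc (Sum.inr e))) g
      ((m.target.isColoring_iff f'.1).1 f'.2).2 hg fun i => by
        rw [← m.target.arc_boundary, hf', hb, m.source.arc_boundary]
    funext e
    obtain ⟨e | e, rfl⟩ := m.target.arc_surjective e
    · exact (hf' e).trans (hk e).symm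
    · exact (congrFun hr e).trans (hk' e).symm

theorem mk_coloring_eq (m : HandlebodyMove Γ Γ') :
    Cardinal.mk (Γ.Coloring X) = Cardinal.mk (Γ'.Coloring X) := by
  choose φ hφ hφ' using fun f : Γ.Coloring X => m.existsUnique_agree f
  choose ψ hψ hψ' using fun f : Γ'.Coloring X => m.symm.existsUnique_agree f
  exact Cardinal.mk_congr ⟨φ, ψ, fun f => (hψ' _ f (m.agree_symm_iff.2 (hφ f))).symm,
    fun f => (hφ' _ f (m.agree_symm_iff.1 (hψ f))).symm⟩

end HandlebodyMove

theorem proposition5p2 {X : Type u} [PartiallyMultiplicativeBiquandle X] :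
    (∀ (Γ Γ' : YDiagram) (m : HandlebodyMove Γ Γ') (f : Γ.Coloring X),
      ∃! f' : Γ'.Coloring X, m.Agree f f') ∧
    (∀ Γ Γ' : YDiagram, HandlebodyEquiv Γ Γ' →
      Cardinal.mk (Γ.Coloring X) = Cardinal.mk (Γ'.Coloring X)) := by
  refine ⟨fun _ _ m f => m.existsUnique_agree f, fun Γ Γ' h => ?_⟩
  induction h with
  | rel Γ Γ' h => exact h.elim fun m => m.mk_coloring_eq
  | refl => rfl
  | symm _ _ _ ih => exact ih.symm
  | trans _ _ _ _ _ ih₁ ih₂ => exact ih₁.trans ih₂
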